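/- Geometries here are point-line incidence geometries. A morphism maps points to points and lines to lines and preserves incidence; an automorphism is a bijective morphism that also preserves non-incidence. For $n\ge 3$, a generalized $n$-gon is a geometry that contains no ordinary $k$-gon for $2\le k<n$, in which any two elements (points or lines) lie in a common ordinary $n$-gon, and which contains an ordinary $(n+1)$-gon. A generalized polygon is a generalized $n$-gon for some $n\ge 3$; a generalized quadrangle is a generalized $4$-gon. A generalized polygon is locally finite (or semi-finite) if, up to duality, every line has finitely many points and every point lies on infinitely many lines. A translation generalized quadrangle (TGQ) $\Gamma^x$ is a generalized quadrangle $\Gamma$ with a point $x$ and an abelian group $T$ of automorphisms of $\Gamma$ that fixes every line through $x$ and acts sharply transitively on the affine points, i.e. the points not collinear with $x$. For an affine point $z$ and a line $V$ through $z$, let $T_V$ be the stabilizer of $V$ in $T$. The kernel $\mathbb{K}$ is the ring of all endomorphisms of the group $T$ that map $T_V$ into itself for every line $V$ through $z$; it does not depend on $z$. The TGQ is linear if $\mathbb{K}$ is a skew field. Let $\mathcal{E}$ be the category whose objects are the pairs $((\Gamma,x),\eta)$, where $\Gamma$ is a generalized polygon, $x$ is a point or a line of $\Gamma$, and $\eta:\Gamma\to\Gamma$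 is a morphism that fixes $x$ and every element incident with $x$, and that is injective but not bijective on the set of points and lines. A morphism $((\Gamma,x),\eta)\to((\Gamma',x'),\eta')$ is a morphism $\beta:\Gamma\to\Gamma'$ with $\beta(x)=x'$ and $\beta\circ\eta=\eta'\circ\beta$. **Theorem.** If $\mathcal{E}$ is empty, then locally finite generalized polygons do not exist, and every TGQ, finite or infinite, whose number of points is not $15$ is linear. More precisely: (a) if $\mathcal{E}$ has no object $((\Gamma,x),\eta)$ with $\Gamma$ locally finite, then locally finite generalized polygons do not exist; (b) if $\mathcal{E}$ has no object $((\Gamma,x),\eta)$ for which $x$ is a point and $\Gamma^x$ is a TGQ (for some group $T$), then every TGQ whose number of points is not $15$ is linear. -/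

import Mathlib

open CategoryTheory

universe u

/-- A point-line incidence geometry. -/
structure IncGeom where
  /-- the points -/
  Pt : Type u
  /-- the lines -/
  Ln : Type u
  /-- incidence -/
  I : Pt → Ln → Prop

namespace IncGeom

/-- The elements (points and lines) of a geometry. -/
abbrev Elt (Γ : IncGeom.{u}) : Type u := Γ.Pt ⊕ Γ.Ln

/-- An ordinary `k`-gon of `Γ` as a subgeometry (used for `2 ≤ k`): `k` distinct points `p i` and
`k` distinct lines `l i`, indexed cyclically, with `p i` and `p (i + 1)` incident with `l i`. -/
structure OrdinaryGon (Γ : IncGeom.{u}) (k : ℕ) where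
  /-- the vertices -/
  p : ZMod k → Γ.Pt
  /-- the sides -/
  l : ZMod k → Γ.Ln
  p_injective : Function.Injective p
  l_injective : Function.Injective l
  inc_left : ∀ i, Γ.I (p i) (l i)
  inc_right : ∀ i, Γ.I (p (i + 1)) (l i)

/-- The element `e` is a vertex or a side of the ordinary `k`-gon `A`. -/
def OrdinaryGon.Contains {Γ : IncGeom.{u}} {k : ℕ} (A : Γ.OrdinaryGon k) : Γ.Elt → Prop
  | .inl q => ∃ i, A.p i = q
  | .inr m => ∃ i, A.l i = m

/-- Generalized `n`-gons (thick). -/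
structure IsGeneralizedNGon (Γ : IncGeom.{u}) (n : ℕ) : Prop where
  three_le : 3 ≤ n
  no_small_gon : ∀ k, 2 ≤ k → k < n → IsEmpty (Γ.OrdinaryGon k)
  exists_gon : ∀ e f : Γ.Elt, ∃ A : Γ.OrdinaryGon n, A.Contains e ∧ A.Contains f
  exists_big_gon : Nonempty (Γ.OrdinaryGon (n + 1))

/-- Generalized polygons. -/
def IsGeneralizedPolygon (Γ : IncGeom.{u}) : Prop := ∃ n, Γ.IsGeneralizedNGon n

/-- Finite lines and infinitely many lines through each point, up to duality. -/
def IsLocallyFinite (Γ : IncGeom.{u}) : Prop :=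
  ((∀ l, {p | Γ.I p l}.Finite) ∧ ∀ p, {l | Γ.I p l}.Infinite) ∨
    ((∀ p, {l | Γ.I p l}.Finite) ∧ ∀ l, {p | Γ.I p l}.Infinite)

/-- Morphisms of geometries: they map points to points and lines to lines, and preserve
incidence. -/
@[ext]
structure Hom (Γ Δ : IncGeom.{u}) where
  /-- action on points -/
  onPt : Γ.Pt → Δ.Pt
  /-- action on lines -/
  onLn : Γ.Ln → Δ.Ln
  inc : ∀ p l, Γ.I p l → Δ.I (onPt p) (onLn l)

/-- The action of a morphism on all elements. -/
def Hom.map {Γ Δ : IncGeom.{u}} (f : Γ.Hom Δ) : Γ.Elt → Δ.Elt := Sum.map f.onPt f.onLn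

/-- The identity morphism. -/
def Hom.id (Γ : IncGeom.{u}) : Γ.Hom Γ := ⟨fun p => p, fun l => l, fun _ _ h => h⟩

/-- Composition (first `f`, then `g`). -/
def Hom.comp {Γ Δ Θ : IncGeom.{u}} (f : Γ.Hom Δ) (g : Δ.Hom Θ) : Γ.Hom Θ :=
  ⟨fun p => g.onPt (f.onPt p), fun l => g.onLn (f.onLn l), fun p l h => g.inc _ _ (f.inc p l h)⟩

theorem Hom.map_id (Γ : IncGeom.{u}) (e : Γ.Elt) : (Hom.id Γ).map e = e := by
  cases e <;> rfl

theorem Hom.map_comp {Γ Δ Θ : IncGeom.{u}} (f : Γ.Hom Δ) (g : Δ.Hom Θ) (e : Γ.Elt) :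
    (f.comp g).map e = g.map (f.map e) := by
  cases e <;> rfl

/-- The endomorphism `η` fixes `x` and every element incident with `x`. -/
def FixesElementwise (Γ : IncGeom.{u}) (η : Γ.Hom Γ) : Γ.Elt → Prop
  | .inl p => η.onPt p = p ∧ ∀ l, Γ.I p l → η.onLn l = l
  | .inr l => η.onLn l = l ∧ ∀ p, Γ.I p l → η.onPt p = p

/-- The automorphism group of a geometry. -/
def Aut (Γ : IncGeom.{u}) : Subgroup (Equiv.Perm Γ.Pt × Equiv.Perm Γ.Ln) where
  carrier := {g | ∀ p l, Γ.I (g.1 p) (g.2 l) ↔ Γ.I p l}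
  one_mem' := fun _ _ => Iff.rfl
  mul_mem' := fun {a b} ha hb p l => (ha (b.1 p) (b.2 l)).trans (hb p l)
  inv_mem' := fun {a} ha p l => by
    have h := ha (a.1⁻¹ p) (a.2⁻¹ l)
    rw [show a.1 (a.1⁻¹ p) = p from Equiv.apply_symm_apply a.1 p,
      show a.2 (a.2⁻¹ l) = l from Equiv.apply_symm_apply a.2 l] at h
    exact h.symm

/-- The affine points with respect to `x`: those not collinear with `x`. -/
def IsAffine (Γ : IncGeom.{u}) (x y : Γ.Pt) : Prop := ¬ ∃ l, Γ.I x l ∧ Γ.I y l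

/-- `T` is an abelian automorphism group that fixes every line through `x` and acts sharply
transitively on the points not collinear with `x`. -/
structure IsTranslationGroup (Γ : IncGeom.{u}) (x : Γ.Pt)
    (T : Subgroup (Equiv.Perm Γ.Pt × Equiv.Perm Γ.Ln)) : Prop where
  le_aut : T ≤ Γ.Aut
  comm : ∀ g ∈ T, ∀ h ∈ T, g * h = h * g
  fix : ∀ g ∈ T, ∀ l, Γ.I x l → g.2 l = l
  sharply_transitive : ∀ y z, Γ.IsAffine x y → Γ.IsAffine x z → ∃! g, g ∈ T ∧ g.1 y = z

/-- `x` is a translation point of the generalized quadrangle `Γ`. -/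
def IsTranslationQuadrangleAt (Γ : IncGeom.{u}) (x : Γ.Pt) : Prop :=
  Γ.IsGeneralizedNGon 4 ∧ ∃ T, Γ.IsTranslationGroup x T

end IncGeom

/-- A pointed generalized polygon; the base element is a point or a line. -/
structure PointedPolygon where
  /-- the polygon -/
  Γ : IncGeom.{u}
  isPolygon : Γ.IsGeneralizedPolygon
  /-- the base element -/
  x : Γ.Elt

/-- Objects of the category `ℰ`: a pointed generalized polygon with an endomorphism that fixes the
base element elementwise and is injective but not bijective. -/
structure CatE where
  /-- the pointed polygon -/
  X : PointedPolygon.{u}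
  /-- the endomorphism -/
  η : X.Γ.Hom X.Γ
  fixes : X.Γ.FixesElementwise η X.x
  injective : Function.Injective η.map
  not_bijective : ¬ Function.Bijective η.map

namespace CatE

/-- Morphisms of `ℰ`: pointed morphisms commuting with the distinguished endomorphisms. -/
@[ext]
structure Hom (A B : CatE.{u}) where
  /-- the morphism of geometries -/
  β : A.X.Γ.Hom B.X.Γ
  pointed : β.map A.X.x = B.X.x
  commutes : A.η.comp β = β.comp B.η

instance : Category CatE.{u} where
  Hom A B := Hom A B
  id A := ⟨IncGeom.Hom.id _, IncGeom.Hom.map_id _ _, rfl⟩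
  comp {A B C} f g := ⟨f.β.comp g.β, by
      rw [IncGeom.Hom.map_comp, f.pointed, g.pointed], by
      change (A.η.comp f.β).comp g.β = f.β.comp (g.β.comp C.η)
      rw [f.commutes, ← g.commutes]
      rfl⟩

/-- The pointed polygon of `A` is a translation generalized quadrangle with its translation
point. -/
def IsTGQ (A : CatE.{u}) : Prop :=
  ∃ p : A.X.Γ.Pt, A.X.x = Sum.inl p ∧ A.X.Γ.IsTranslationQuadrangleAt p

end CatE

/-- A translation generalized quadrangle, with its translation point and translation group. -/
structure TGQ where
  /-- the quadrangle -/
  Γ : IncGeom.{u}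
  isQuadrangle : Γ.IsGeneralizedNGon 4
  /-- the translation point -/
  x : Γ.Pt
  /-- the translation group -/
  T : Subgroup (Equiv.Perm Γ.Pt × Equiv.Perm Γ.Ln)
  isTranslationGroup : Γ.IsTranslationGroup x T

/-- A ring is a skew field. -/
def IsSkewField (R : Type*) [Ring R] : Prop := Nontrivial R ∧ ∀ a : R, a ≠ 0 → IsUnit a

namespace TGQ

instance instCommGroupT (Q : TGQ.{u}) : CommGroup Q.T :=
  { (inferInstance : Group Q.T) with
    mul_comm := fun a b => Subtype.ext (Q.isTranslationGroup.comm a a.2 b b.2) }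

/-- The subgroup `T_V` of translations stabilizing the line `V`. -/
def lineStab (Q : TGQ.{u}) (V : Q.Γ.Ln) : Subgroup Q.T where
  carrier := {t | t.1.2 V = V}
  one_mem' := rfl
  mul_mem' := fun {a b} ha hb => by
    change a.1.2 (b.1.2 V) = V
    rw [show b.1.2 V = V from hb, show a.1.2 V = V from ha]
  inv_mem' := fun {a} ha => by
    change a.1.2⁻¹ V = V
    rw [Equiv.Perm.inv_eq_iff_eq]
    exact (show a.1.2 V = V from ha).symm

/-- The kernel: the ring of all endomorphisms of the abelian group `T` that map `T_V` into itself
for every line `V` through the affine point `z`. (`Additive` only switches to additive notation, so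
that the endomorphisms form a ring.) -/
def kernel (Q : TGQ.{u}) (z : Q.Γ.Pt) : Subring (AddMonoid.End (Additive Q.T)) where
  carrier := {α | ∀ V, Q.Γ.I z V → ∀ t : Q.T, t ∈ Q.lineStab V →
    (α (Additive.ofMul t)).toMul ∈ Q.lineStab V}
  one_mem' := fun _ _ _ ht => ht
  mul_mem' := fun {_ b} ha hb V hV t ht => ha V hV (b (Additive.ofMul t)).toMul (hb V hV t ht)
  zero_mem' := fun V _ _ _ => (Q.lineStab V).one_mem
  add_mem' := fun ha hb V hV t ht => (Q.lineStab V).mul_mem (ha V hV t ht) (hb V hV t ht)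
  neg_mem' := fun ha V hV t ht => (Q.lineStab V).inv_mem (ha V hV t ht)

/-- The quadrangle is linear: its kernel is a skew field. (Up to equality the kernel does not
depend on the affine point `z`, since `T` is abelian and transitive on affine points.) -/
def IsLinear (Q : TGQ.{u}) : Prop := ∀ z, Q.Γ.IsAffine Q.x z → IsSkewField (Q.kernel z)

end TGQ

/-! Part (a). Up to duality, lines are finite and every point lies on infinitely many lines. Every
line is opposite to an element of one fixed ordinary (n+1)-gon, and opposite elements have equally
many neighbours, so line sizes are bounded (`exists_ncard_le`). Form a limit ultrapower: functions
of finitely many terms of a sequence of naturals, modulo an ultrafilter that measures the first k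
terms by the k-fold product of a nonprincipal ultrafilter. It is again a generalized n-gon with
finite lines and infinite pencils. Dropping the first term of the sequence preserves this measure,
so it induces an injective endomorphism. This endomorphism fixes constants, hence a constant line,
and hence its points, which bounded line size forces to be constant. It misses any line that
genuinely depends on the first term, so it is not bijective (`not_surjective_push`).

Part (b). Fix an affine point z. To each line V on z belong the stabilizer of V and the larger
stabilizer of the foot of V, its point collinear with x; `IsTranslationFamily` records the group
theory of these subgroups. Let α be a nonzero kernel element. If α kills a nonzero element of some
line stabilizer, then there are only three lines on z and their stabilizers have order two
(`exceptional_of_map_eq_zero`), so T has order 8 and there are 15 points. Otherwise α is injective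
and both preserves and reflects all the subgroups. As points and lines are translates of x, z, the
feet, and the lines on x or z, α then induces an injective endomorphism of the quadrangle
(`TGQ.exists_catE`). If α were not surjective, this would be an object of the category; so α is
bijective, and its inverse lies in the kernel. -/

namespace IncGeom

variable {Γ : IncGeom.{u}} {n k : ℕ}

/-! ### Duality, the incidence graph, and projection between opposite elements. -/

/-- The dual geometry, with points and lines interchanged. -/
def dual (Γ : IncGeom.{u}) : IncGeom.{u} := ⟨Γ.Ln, Γ.Pt, fun l p => Γ.I p l⟩

/-- The dual of an ordinary polygon. -/
def OrdinaryGon.dual (A : Γ.OrdinaryGon k) : Γ.dual.OrdinaryGon k where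
  p := A.l
  l := fun i => A.p (i + 1)
  p_injective := A.l_injective
  l_injective := fun _ _ h => add_right_cancel (A.p_injective h)
  inc_left := A.inc_right
  inc_right := fun i => A.inc_left (i + 1)

theorem IsGeneralizedNGon.dual (h : Γ.IsGeneralizedNGon n) : Γ.dual.IsGeneralizedNGon n where
  three_le := h.three_le
  no_small_gon := fun k h2 hk => ⟨fun A => (h.no_small_gon k h2 hk).false (A.dual : Γ.OrdinaryGon k)⟩
  exists_gon := by
    have key : ∀ (A : Γ.OrdinaryGon n) (e : Γ.dual.Elt), A.Contains e.swap → A.dual.Contains e := by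
      rintro A (l | p) ⟨i, hi⟩
      · exact ⟨i, hi⟩
      · exact ⟨i - 1, (congrArg A.p (sub_add_cancel i 1)).trans hi⟩
    intro e f
    obtain ⟨A, he, hf⟩ := h.exists_gon e.swap f.swap
    exact ⟨A.dual, key A e he, key A f hf⟩
  exists_big_gon := h.exists_big_gon.map fun A => A.dual

/-- The incidence graph. -/
def incGraph (Γ : IncGeom.{u}) : SimpleGraph Γ.Elt where
  Adj
    | .inl p, .inr l => Γ.I p l
    | .inr l, .inl p => Γ.I p l
    | _, _ => False
  symm := ⟨by rintro (p | l) (q | m) h <;> exact h⟩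
  loopless := ⟨by rintro (p | l) h <;> exact h⟩

theorem incGraph_adj_inl_inr {p : Γ.Pt} {l : Γ.Ln} : Γ.incGraph.Adj (.inl p) (.inr l) ↔ Γ.I p l :=
  Iff.rfl

theorem isLeft_eq_not_of_adj {e f : Γ.Elt} (h : Γ.incGraph.Adj e f) : f.isLeft = !e.isLeft := by
  rcases e with p | l <;> rcases f with q | m <;> first | rfl | exact h.elim

theorem even_length_iff {e f : Γ.Elt} (w : Γ.incGraph.Walk e f) :
    Even w.length ↔ e.isLeft = f.isLeft := by
  induction w with
  | nil => simp
  | cons h w ih =>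
    rw [SimpleGraph.Walk.length_cons, Nat.even_add_one, ih, isLeft_eq_not_of_adj h]
    cases Sum.isLeft _ <;> cases Sum.isLeft _ <;> simp

/-- The incidence graph is bipartite, so the two distances have different parity. -/
theorem dist_ne_of_adj (hc : Γ.incGraph.Connected) {e f : Γ.Elt} (h : Γ.incGraph.Adj e f)
    (a : Γ.Elt) : Γ.incGraph.dist a e ≠ Γ.incGraph.dist a f := by
  obtain ⟨w, hw⟩ := hc.exists_walk_length_eq_dist a e
  obtain ⟨w', hw'⟩ := hc.exists_walk_length_eq_dist a f
  intro heq
  have h1 := even_length_iff w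
  have h2 := even_length_iff w'
  rw [hw] at h1
  rw [hw', ← heq, h1, isLeft_eq_not_of_adj h] at h2
  revert h2
  cases Sum.isLeft _ <;> cases Sum.isLeft _ <;> simp

theorem dist_adj_le (hc : Γ.incGraph.Connected) {e f : Γ.Elt} (h : Γ.incGraph.Adj e f)
    (a : Γ.Elt) : Γ.incGraph.dist a f ≤ Γ.incGraph.dist a e + 1 := by
  have := hc.dist_triangle (u := a) (v := e) (w := f)
  rwa [SimpleGraph.dist_eq_one_iff_adj.2 h] at this

theorem exists_geodesic (hc : Γ.incGraph.Connected) (a b : Γ.Elt) :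
    ∃ u : ℕ → Γ.Elt, u 0 = a ∧ u (Γ.incGraph.dist a b) = b ∧
      (∀ i < Γ.incGraph.dist a b, Γ.incGraph.Adj (u i) (u (i + 1))) ∧
      (∀ i ≤ Γ.incGraph.dist a b, Γ.incGraph.dist a (u i) = i) ∧
      ∀ i ≤ Γ.incGraph.dist a b, Γ.incGraph.dist (u i) b = Γ.incGraph.dist a b - i := by
  obtain ⟨w, hw⟩ := hc.exists_walk_length_eq_dist a b
  have h1 : ∀ i ≤ w.length, Γ.incGraph.dist a (w.getVert i) ≤ i := fun i hi => by
    have := SimpleGraph.dist_le (w.take i)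
    rwa [SimpleGraph.Walk.take_length, min_eq_left hi] at this
  have h2 : ∀ i ≤ w.length, Γ.incGraph.dist (w.getVert i) b ≤ w.length - i := fun i hi => by
    have := SimpleGraph.dist_le (w.drop i)
    rwa [SimpleGraph.Walk.drop_length] at this
  have h3 : ∀ i, Γ.incGraph.dist a b ≤
      Γ.incGraph.dist a (w.getVert i) + Γ.incGraph.dist (w.getVert i) b := fun i =>
    hc.dist_triangle
  refine ⟨w.getVert, w.getVert_zero, by rw [← hw, w.getVert_length], fun i hi =>
    w.adj_getVert_succ (by omega), fun i hi => ?_, fun i hi => ?_⟩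
  · have := h1 i (by omega); have := h2 i (by omega); have := h3 i; omega
  · have := h1 i (by omega); have := h2 i (by omega); have := h3 i; omega

theorem nonempty_ordinaryGon_of_seq {d : ℕ} (hd : 0 < d) (P : ℕ → Γ.Pt) (M : ℕ → Γ.Ln)
    (h1 : ∀ j < d, Γ.I (P j) (M j)) (h2 : ∀ j < d, Γ.I (P (j + 1)) (M j)) (h0 : P d = P 0)
    (hP : Set.InjOn P (Set.Iio d)) (hM : Set.InjOn M (Set.Iio d)) :
    Nonempty (Γ.OrdinaryGon d) := by
  have : NeZero d := ⟨hd.ne'⟩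
  refine ⟨⟨fun i => P i.val, fun i => M i.val, fun i j h => ?_, fun i j h => ?_,
    fun i => h1 _ i.val_lt, fun i => ?_⟩⟩
  · exact ZMod.val_injective _ (hP i.val_lt j.val_lt h)
  · exact ZMod.val_injective _ (hM i.val_lt j.val_lt h)
  · have hcast : ((i.val + 1 : ℕ) : ZMod d) = i + 1 := by simp
    by_cases hi : i.val + 1 < d
    · rw [← hcast, ZMod.val_natCast_of_lt hi]
      exact h2 _ i.val_lt
    · have hlt := i.val_lt
      have hi' : i.val + 1 = d := by omega
      have h3 := h2 _ hlt
      rw [← hcast, show ((i.val + 1 : ℕ) : ZMod d) = 0 by rw [hi']; simp, ZMod.val_zero, ← h0]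
      rwa [show P (i.val + 1) = P d by rw [hi']] at h3

theorem nonempty_ordinaryGon_of_cycle {d : ℕ} (hd : 0 < d) (c : ℕ → Γ.Elt)
    (hadj : ∀ i < 2 * d, Γ.incGraph.Adj (c i) (c (i + 1))) (h0 : c (2 * d) = c 0)
    (hinj : Set.InjOn c (Set.Iio (2 * d))) : Nonempty (Γ.OrdinaryGon d) := by
  have hl : ∀ i ≤ 2 * d, (c i).isLeft = if Even i then (c 0).isLeft else !(c 0).isLeft := by
    intro i
    induction i with
    | zero => simp
    | succ i ih =>
      intro hi
      rw [isLeft_eq_not_of_adj (hadj i (by omega)), ih (by omega)]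
      by_cases he : Even i <;> simp [he, Nat.even_add_one]
  have hl0 : ∀ j ≤ d, (c (2 * j)).isLeft = (c 0).isLeft := fun j hj => by
    rw [hl _ (by omega)]; simp
  have hl1 : ∀ j < d, (c (2 * j + 1)).isLeft = !(c 0).isLeft := fun j hj => by
    rw [hl _ (by omega)]; simp
  cases hc : (c 0).isLeft with
  | true =>
    obtain ⟨p0, hp0⟩ := Sum.isLeft_iff.1 hc
    have hc1 : (c 1).isLeft = false := by rw [hl1 0 hd, hc]; rfl
    obtain ⟨l0, hl0'⟩ := Sum.isRight_iff.1 (by simpa using hc1 : (c 1).isRight = true)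
    have : Nonempty Γ.Pt := ⟨p0⟩
    have : Nonempty Γ.Ln := ⟨l0⟩
    choose! P hP using fun j (hj : j ≤ d) => Sum.isLeft_iff.1 ((hl0 j hj).trans hc)
    choose! M hM using fun j (hj : j < d) => Sum.isRight_iff.1
      (Sum.not_isLeft.1 (by rw [hl1 j hj, hc]; simp) : (c (2 * j + 1)).isRight = true)
    refine nonempty_ordinaryGon_of_seq hd P M (fun j hj => ?_) (fun j hj => ?_) ?_
      (fun i hi j hj h => ?_) (fun i hi j hj h => ?_)
    · have := hadj (2 * j) (by omega)
      rwa [hP j hj.le, hM j hj] at this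
    · have := (hadj (2 * j + 1) (by omega)).symm
      rwa [hM j hj, show 2 * j + 1 + 1 = 2 * (j + 1) by ring, hP (j + 1) hj] at this
    · have h := hP d le_rfl
      rw [h0] at h
      exact Sum.inl_injective (h.symm.trans (hP 0 (by omega)))
    · rw [Set.mem_Iio] at hi hj
      have := hinj (Set.mem_Iio.2 (by omega : 2 * i < 2 * d)) (Set.mem_Iio.2 (by omega : 2 * j < _))
        (by rw [hP i hi.le, hP j hj.le, h])
      omega
    · rw [Set.mem_Iio] at hi hj
      have := hinj (Set.mem_Iio.2 (by omega : 2 * i + 1 < 2 * d))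
        (Set.mem_Iio.2 (by omega : 2 * j + 1 < _)) (by rw [hM i hi, hM j hj, h])
      omega
  | false =>
    obtain ⟨l0, hl0'⟩ := Sum.isRight_iff.1 (by simpa using hc : (c 0).isRight = true)
    have hc1 : (c 1).isLeft = true := by rw [hl1 0 hd, hc]; rfl
    obtain ⟨p0, hp0⟩ := Sum.isLeft_iff.1 hc1
    have : Nonempty Γ.Pt := ⟨p0⟩
    have : Nonempty Γ.Ln := ⟨l0⟩
    choose! M hM using fun j (hj : j ≤ d) => Sum.isRight_iff.1
      (Sum.not_isLeft.1 (by rw [hl0 j hj, hc]; simp) : (c (2 * j)).isRight = true)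
    choose! P hP using fun j (hj : j < d) => Sum.isLeft_iff.1
      (by simp [hl1 j hj, hc] : (c (2 * j + 1)).isLeft = true)
    -- The cycle starts at a line, so it is read as a polygon of the dual geometry.
    suffices h : Nonempty (Γ.dual.OrdinaryGon d) from h.map fun A => A.dual
    refine nonempty_ordinaryGon_of_seq (Γ := Γ.dual) hd M P (fun j hj => ?_) (fun j hj => ?_) ?_
      (fun i hi j hj h => ?_) (fun i hi j hj h => ?_)
    · have := hadj (2 * j) (by omega)
      rwa [hM j hj.le, hP j hj] at this
    · have := (hadj (2 * j + 1) (by omega)).symm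
      rwa [hP j hj, show 2 * j + 1 + 1 = 2 * (j + 1) by ring, hM (j + 1) hj] at this
    · have h := hM d le_rfl
      rw [h0] at h
      exact Sum.inr_injective (h.symm.trans (hM 0 (by omega)))
    · rw [Set.mem_Iio] at hi hj
      have := hinj (Set.mem_Iio.2 (by omega : 2 * i < 2 * d)) (Set.mem_Iio.2 (by omega : 2 * j < _))
        (by rw [hM i hi.le, hM j hj.le, h])
      omega
    · rw [Set.mem_Iio] at hi hj
      have := hinj (Set.mem_Iio.2 (by omega : 2 * i + 1 < 2 * d))
        (Set.mem_Iio.2 (by omega : 2 * j + 1 < _)) (by rw [hP i hi, hP j hj, h])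
      omega

/-- Below distance n geodesics are unique. Geodesics from a to two distinct predecessors of b meet
only at a, because an earlier meeting point would contradict the claim at a smaller distance; closed
up through b they form an ordinary d-gon with d < n. -/
theorem eq_of_adj_of_dist (hc : Γ.incGraph.Connected)
    (hgon : ∀ k, 2 ≤ k → k < n → IsEmpty (Γ.OrdinaryGon k)) :
    ∀ d < n, ∀ a b c c' : Γ.Elt, Γ.incGraph.dist a b = d → Γ.incGraph.Adj c b →
      Γ.incGraph.Adj c' b → Γ.incGraph.dist a c + 1 = d → Γ.incGraph.dist a c' + 1 = d →
      c = c' := by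
  intro d
  induction d using Nat.strong_induction_on with
  | _ d ih =>
  intro hd a b c c' hab hcb hcb' hac hac'
  by_contra hne
  have hd2 : 2 ≤ d := by
    by_contra hlt
    have h1 : Γ.incGraph.dist a c = 0 := by omega
    have h2 : Γ.incGraph.dist a c' = 0 := by omega
    exact hne ((hc.dist_eq_zero_iff.1 h1).symm.trans (hc.dist_eq_zero_iff.1 h2))
  obtain ⟨u, hu0, hud, hua, hu, hub⟩ := exists_geodesic hc a c
  obtain ⟨v, hv0, hvd, hva, hv, hvb⟩ := exists_geodesic hc a c'
  rw [show Γ.incGraph.dist a c = d - 1 by omega] at hud hua hu hub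
  rw [show Γ.incGraph.dist a c' = d - 1 by omega] at hvd hva hv hvb
  have hdisj : ∀ i, 0 < i → i < d → u i ≠ v i := by
    intro i hi0 hid huv
    have h1 := hub i (by omega)
    have h2 := hvb i (by omega)
    rw [← huv] at h2
    have h3 : Γ.incGraph.dist (u i) b = d - i := by
      have h4 := hc.dist_triangle (u := a) (v := u i) (w := b)
      rw [hu i (by omega), hab] at h4
      have h5 := dist_adj_le hc hcb (u i)
      omega
    exact hne (ih (d - i) (by omega) (by omega) (u i) b c c' h3 hcb hcb' (by omega) (by omega))
  refine (hgon d hd2 hd).elim' (nonempty_ordinaryGon_of_cycle (by omega)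
    (fun i => if i < d then u i else if i = d then b else v (2 * d - i)) ?_ ?_ ?_).some
  · intro i hi
    rcases lt_trichotomy i d with h | h | h
    · by_cases h' : i + 1 < d
      · rw [if_pos h, if_pos h']; exact hua i (by omega)
      · rw [if_pos h, if_neg h', if_pos (by omega), show i = d - 1 by omega, hud]; exact hcb
    · rw [if_neg (by omega), if_pos h, if_neg (by omega), if_neg (by omega),
        show 2 * d - (i + 1) = d - 1 by omega, hvd]
      exact hcb'.symm
    · rw [if_neg (by omega), if_neg (by omega), if_neg (by omega), if_neg (by omega)]
      have := (hva (2 * d - (i + 1)) (by omega)).symm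
      rwa [show 2 * d - (i + 1) + 1 = 2 * d - i by omega] at this
  · rw [if_neg (by omega), if_neg (by omega), if_pos (by omega), Nat.sub_self, hu0, hv0]
  -- The distance from a rises to d along the first geodesic and falls along the second, so a
  -- repetition can only pair elements at equal height, which `hdisj` excludes.
  · have key : ∀ i < 2 * d, Γ.incGraph.dist a
        (if i < d then u i else if i = d then b else v (2 * d - i)) =
          if i ≤ d then i else 2 * d - i := by
      intro i hi
      split_ifs with h1 h2 h3 h4 h5
      · exact hu i (by omega)
      · omega
      · omega
      · omega
      · omega
      · exact hv _ (by omega)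
    intro i hi j hj hij
    rw [Set.mem_Iio] at hi hj
    have hk := key i hi
    have hk' := key j hj
    dsimp only at hij
    rw [hij, hk'] at hk
    rcases le_or_gt i d with h1 | h1 <;> rcases le_or_gt j d with h2 | h2
    · rw [if_pos h1, if_pos h2] at hk; exact hk.symm
    · rw [if_pos h1, if_neg (by omega)] at hk
      rw [if_pos (by omega), if_neg (by omega), if_neg (by omega), hk] at hij
      exact (hdisj i (by omega) (by omega) hij).elim
    · rw [if_pos h2, if_neg (by omega)] at hk
      rw [if_neg (by omega), if_neg (by omega), if_pos (by omega), ← hk] at hij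
      exact (hdisj j (by omega) (by omega) hij.symm).elim
    · rw [if_neg (by omega), if_neg (by omega)] at hk; omega

/-- The elements of an ordinary polygon in cyclic order. -/
def OrdinaryGon.elt (A : Γ.OrdinaryGon k) (i : ℕ) : Γ.Elt :=
  if Even i then .inl (A.p (i / 2 : ℕ)) else .inr (A.l (i / 2 : ℕ))

theorem OrdinaryGon.elt_adj (A : Γ.OrdinaryGon k) (i : ℕ) :
    Γ.incGraph.Adj (A.elt i) (A.elt (i + 1)) := by
  rcases Nat.even_or_odd' i with ⟨j, rfl | rfl⟩
  · have h : (2 * j + 1) / 2 = j := by omega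
    simp only [elt, Nat.even_add_one, even_two_mul, if_true, not_true, if_false, h]
    simpa [incGraph_adj_inl_inr] using A.inc_left j
  · have h : (2 * j + 1) / 2 = j := by omega
    have h' : (2 * j + 1 + 1) / 2 = j + 1 := by omega
    simp only [elt, Nat.even_add_one, even_two_mul, if_true, not_true, if_false, h, h', not_false_eq_true]
    refine SimpleGraph.Adj.symm (incGraph_adj_inl_inr.2 ?_)
    simpa using A.inc_right j

theorem OrdinaryGon.elt_add (A : Γ.OrdinaryGon k) (i : ℕ) : A.elt (i + 2 * k) = A.elt i := by
  have h : (i + 2 * k) / 2 = i / 2 + k := by omega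
  simp [elt, h, Nat.even_add]

theorem OrdinaryGon.elt_add_two_ne (A : Γ.OrdinaryGon k) (hk : 2 ≤ k) (i : ℕ) :
    A.elt (i + 2) ≠ A.elt i := by
  have : Fact (1 < k) := ⟨hk⟩
  have h : (i + 2) / 2 = i / 2 + 1 := by omega
  by_cases hi : Even i
  · simp [elt, h, Nat.even_add, hi, A.p_injective.eq_iff]
  · simp [elt, h, Nat.even_add, hi, A.l_injective.eq_iff]

theorem OrdinaryGon.Contains.exists_elt {A : Γ.OrdinaryGon k} [NeZero k] {e : Γ.Elt}
    (h : A.Contains e) : ∃ i < 2 * k, A.elt i = e := by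
  rcases e with p | l
  · obtain ⟨i, rfl⟩ := h
    exact ⟨2 * i.val, by have := i.val_lt; omega, by simp [elt]⟩
  · obtain ⟨i, rfl⟩ := h
    have h' : (2 * i.val + 1) / 2 = i.val := by omega
    exact ⟨2 * i.val + 1, by have := i.val_lt; omega, by simp [elt, h']⟩

theorem OrdinaryGon.exists_walk (A : Γ.OrdinaryGon k) (i j : ℕ) :
    ∃ w : Γ.incGraph.Walk (A.elt i) (A.elt (i + j)), w.length = j := by
  induction j with
  | zero => exact ⟨.nil, rfl⟩
  | succ j ih =>
    obtain ⟨w, hw⟩ := ih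
    exact ⟨w.concat (A.elt_adj _), by simp [hw]⟩

namespace IsGeneralizedNGon

variable (h : Γ.IsGeneralizedNGon n)
include h

/-- Two elements of an n-gon split its 2n steps into two arcs, and the shorter has length at most n.
-/
theorem exists_walk (e f : Γ.Elt) : ∃ w : Γ.incGraph.Walk e f, w.length ≤ n := by
  have : NeZero n := ⟨by have := h.three_le; omega⟩
  obtain ⟨A, he, hf⟩ := h.exists_gon e f
  obtain ⟨i, hi, rfl⟩ := he.exists_elt
  obtain ⟨j, hj, rfl⟩ := hf.exists_elt
  have key : ∀ i j, i ≤ j → j < 2 * n →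
      ∃ w : Γ.incGraph.Walk (A.elt i) (A.elt j), w.length ≤ n := by
    intro i j hij hj
    by_cases hn : j ≤ i + n
    · obtain ⟨w, hw⟩ := A.exists_walk i (j - i)
      exact ⟨w.copy rfl (by congr 1; omega), by rw [SimpleGraph.Walk.length_copy]; omega⟩
    · obtain ⟨w, hw⟩ := A.exists_walk j (i + 2 * n - j)
      exact ⟨(w.copy rfl (by rw [← A.elt_add i]; congr 1; omega)).reverse, by
        rw [SimpleGraph.Walk.length_reverse, SimpleGraph.Walk.length_copy]; omega⟩
  rcases le_total i j with hij | hij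
  · exact key i j hij hj
  · obtain ⟨w, hw⟩ := key j i hij hi
    exact ⟨w.reverse, by rwa [SimpleGraph.Walk.length_reverse]⟩

theorem connected : Γ.incGraph.Connected := by
  obtain ⟨A⟩ := h.exists_big_gon
  have : Nonempty Γ.Elt := ⟨A.elt 0⟩
  exact ⟨fun e f => ⟨(h.exists_walk e f).choose⟩⟩

theorem dist_le (e f : Γ.Elt) : Γ.incGraph.dist e f ≤ n := by
  obtain ⟨w, hw⟩ := h.exists_walk e f
  exact (SimpleGraph.dist_le w).trans hw

theorem eq_of_closer {a b c c' : Γ.Elt} (hab : Γ.incGraph.dist a b < n)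
    (hcb : Γ.incGraph.Adj c b) (hcb' : Γ.incGraph.Adj c' b)
    (hac : Γ.incGraph.dist a c + 1 = Γ.incGraph.dist a b)
    (hac' : Γ.incGraph.dist a c' + 1 = Γ.incGraph.dist a b) : c = c' :=
  eq_of_adj_of_dist h.connected h.no_small_gon _ hab a b c c' rfl hcb hcb' hac hac'

theorem dist_adj (a : Γ.Elt) {b c : Γ.Elt} (hbc : Γ.incGraph.Adj b c) :
    Γ.incGraph.dist a c = Γ.incGraph.dist a b + 1 ∨
      Γ.incGraph.dist a c + 1 = Γ.incGraph.dist a b := by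
  have h1 := dist_adj_le h.connected hbc a
  have h2 := dist_adj_le h.connected hbc.symm a
  have h3 := dist_ne_of_adj h.connected hbc a
  omega

/-- Every element is opposite to some element of a given ordinary polygon. -/
theorem exists_opposite_elt (A : Γ.OrdinaryGon k) (hk : 2 ≤ k) (f : Γ.Elt) :
    ∃ i < 2 * k, Γ.incGraph.dist f (A.elt i) = n := by
  -- An element of the polygon farthest from f works: at distance less than n, both its polygon
  -- neighbours would be closer to f, hence equal by uniqueness of geodesics.
  obtain ⟨i, hi, hmax⟩ := Finset.exists_max_image (Finset.range (2 * k))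
    (fun i => Γ.incGraph.dist f (A.elt i)) ⟨0, by simp; omega⟩
  rw [Finset.mem_range] at hi
  have hper : ∀ j, ∃ j' < 2 * k, A.elt j = A.elt j' := by
    intro j
    induction j using Nat.strong_induction_on with
    | _ j ih =>
      by_cases hj : j < 2 * k
      · exact ⟨j, hj, rfl⟩
      · obtain ⟨j', hj', he⟩ := ih (j - 2 * k) (by omega)
        refine ⟨j', hj', ?_⟩
        rw [← he, ← A.elt_add (j - 2 * k)]
        congr 1; omega
  have hmax' : ∀ j, Γ.incGraph.dist f (A.elt j) ≤ Γ.incGraph.dist f (A.elt i) := fun j => by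
    obtain ⟨j', hj', he⟩ := hper j
    rw [he]; exact hmax j' (Finset.mem_range.2 hj')
  refine ⟨i, hi, ?_⟩
  by_contra hne
  have hlt : Γ.incGraph.dist f (A.elt i) < n := lt_of_le_of_ne (h.dist_le _ _) hne
  have hadj1 := A.elt_adj (i + 2 * k - 1)
  have he : A.elt (i + 2 * k - 1 + 1) = A.elt i := by
    rw [← A.elt_add i]; congr 1; omega
  rw [he] at hadj1
  have hadj2 := A.elt_adj i
  have h1 := h.dist_adj f hadj1.symm
  have h2 := h.dist_adj f hadj2
  have h3 := hmax' (i + 2 * k - 1)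
  have h4 := hmax' (i + 1)
  have heq := h.eq_of_closer hlt hadj1 hadj2.symm (by omega) (by omega)
  apply A.elt_add_two_ne hk (i + 2 * k - 1)
  rw [heq, ← A.elt_add (i + 1)]
  congr 1; omega

/-- The projection from the neighbours of an element to those of an opposite element. -/
theorem exists_injective_of_opposite {e f : Γ.Elt} (hef : Γ.incGraph.dist e f = n) :
    ∃ φ : Γ.incGraph.neighborSet e → Γ.incGraph.neighborSet f, Function.Injective φ := by
  have hn := h.three_le
  have key : ∀ p : Γ.incGraph.neighborSet e, ∃ q : Γ.incGraph.neighborSet f,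
      Γ.incGraph.dist (p : Γ.Elt) q + 2 = n := by
    rintro ⟨p, hp⟩
    have hp' : Γ.incGraph.Adj e p := hp
    have h1 : Γ.incGraph.dist p f + 1 = n := by
      have := h.dist_adj f hp'
      have h2 := h.dist_le p f
      rw [SimpleGraph.dist_comm, SimpleGraph.dist_comm (u := f) (v := e)] at this
      omega
    obtain ⟨u, hu0, hud, hua, hu, hub⟩ := exists_geodesic h.connected p f
    refine ⟨⟨u (Γ.incGraph.dist p f - 1), ?_⟩, ?_⟩
    · have := hua (Γ.incGraph.dist p f - 1) (by omega)
      rw [show Γ.incGraph.dist p f - 1 + 1 = Γ.incGraph.dist p f by omega, hud] at this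
      exact this.symm
    · rw [hu _ (by omega)]; omega
  choose φ hφ using key
  refine ⟨φ, fun p p' hpp => ?_⟩
  have h1 := hφ p
  have h2 := hφ p'
  rw [← hpp] at h2
  have hq : Γ.incGraph.Adj f (φ p) := (φ p).2
  have hp : Γ.incGraph.Adj e p := p.2
  have hp' : Γ.incGraph.Adj e p' := p'.2
  have h3 := h.dist_adj e hq
  have h4 := h.dist_adj (φ p : Γ.Elt) hp
  have h5 := h.dist_le e (φ p)
  -- The image q of p has distance n - 1 from e and n - 2 from p, so p is recovered from q as the
  -- only neighbour of e closer to q.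
  rw [SimpleGraph.dist_comm] at h1 h2
  rw [SimpleGraph.dist_comm (u := e) (v := (φ p : Γ.Elt)), hef] at h3
  exact Subtype.ext (h.eq_of_closer (a := (φ p : Γ.Elt)) (b := e) (by omega) hp.symm hp'.symm
    (by omega) (by omega))

/-- A path without backtracking is geodesic up to length n: if the distance dropped, the last
element but one would have two distinct neighbours closer to the start. -/
theorem dist_elt_add (A : Γ.OrdinaryGon k) (hk : 2 ≤ k) (i : ℕ) :
    ∀ j ≤ n, Γ.incGraph.dist (A.elt i) (A.elt (i + j)) = j := by
  intro j
  induction j using Nat.strong_induction_on with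
  | _ j ih =>
  intro hj
  match j with
  | 0 => simp
  | 1 => exact SimpleGraph.dist_eq_one_iff_adj.2 (A.elt_adj i)
  | j + 2 =>
    have h1 := ih j (by omega) (by omega)
    have h2 := ih (j + 1) (by omega) (by omega)
    rcases h.dist_adj (A.elt i) (A.elt_adj (i + (j + 1))) with h3 | h3
    · rw [h2] at h3; exact h3
    · exact (A.elt_add_two_ne hk (i + j) (h.eq_of_closer (a := A.elt i) (by omega)
        (A.elt_adj (i + (j + 1))).symm (A.elt_adj (i + j)) (by omega) (by rw [h1]; exact h2.symm))).elim

/-- Thickness: every element is incident with at least three others. -/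
theorem exists_three_adj (e : Γ.Elt) : ∃ a b c, Γ.incGraph.Adj e a ∧ Γ.incGraph.Adj e b ∧
    Γ.incGraph.Adj e c ∧ a ≠ b ∧ a ≠ c ∧ b ≠ c := by
  obtain ⟨A⟩ := h.exists_big_gon
  have hn := h.three_le
  have hk : 2 ≤ n + 1 := by omega
  obtain ⟨i, -, hi⟩ := h.exists_opposite_elt A hk e
  obtain ⟨φ, hφ⟩ := h.exists_injective_of_opposite ((SimpleGraph.dist_comm).trans hi)
  have hd := fun i j hj => h.dist_elt_add A hk i j hj
  have h0 : A.elt (i + 2 * (n + 1)) = A.elt i := A.elt_add i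
  have hprev : Γ.incGraph.Adj (A.elt i) (A.elt (i + (2 * n + 1))) := by
    rw [← h0]; exact (A.elt_adj (i + (2 * n + 1))).symm
  have hopp : Γ.incGraph.dist (A.elt i) (A.elt (i + (n + 1))) + 1 = n := by
    have h1 := hd i n le_rfl
    have h2 := h.dist_adj (A.elt i) (A.elt_adj (i + n))
    have h3 := h.dist_le (A.elt i) (A.elt (i + (n + 1)))
    rw [← add_assoc] at h3 ⊢
    omega
  rw [SimpleGraph.dist_comm] at hopp
  obtain ⟨u, hu0, hud, hua, hu, -⟩ :=
    exists_geodesic h.connected (A.elt (i + (n + 1))) (A.elt i)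
  set d := Γ.incGraph.dist (A.elt (i + (n + 1))) (A.elt i) with hd'
  -- The third neighbour is the first step from `A.elt i` towards the antipode `A.elt (i + (n +
  -- 1))`. Its distance from the antipode is n - 2, whereas both neighbours inside the (n+1)-gon
  -- have distance n from it.
  have hu1 : Γ.incGraph.Adj (A.elt i) (u (d - 1)) := by
    have := hua (d - 1) (by omega)
    rw [show d - 1 + 1 = d by omega, hud] at this
    exact this.symm
  have hu2 := hu (d - 1) (by omega)
  have hx1 : u (d - 1) ≠ A.elt (i + 1) := fun heq => by
    have := hd (i + 1) n le_rfl
    rw [heq, SimpleGraph.dist_comm, show i + (n + 1) = i + 1 + n by ring] at hu2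
    omega
  have hx2 : u (d - 1) ≠ A.elt (i + (2 * n + 1)) := fun heq => by
    have := hd (i + (n + 1)) n le_rfl
    rw [heq, show i + (2 * n + 1) = i + (n + 1) + n by ring] at hu2
    omega
  have hx3 : A.elt (i + (2 * n + 1)) ≠ A.elt (i + 1) := fun heq => by
    refine A.elt_add_two_ne hk (i + (2 * n + 1)) ?_
    rw [heq, ← A.elt_add (i + 1)]; congr 1; ring
  refine ⟨φ ⟨_, hu1⟩, φ ⟨_, A.elt_adj i⟩, φ ⟨_, hprev⟩, Subtype.prop _, Subtype.prop _,
    Subtype.prop _, ?_, ?_, ?_⟩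
  · exact fun heq => hx1 (Subtype.ext_iff.1 (hφ (Subtype.ext heq)))
  · exact fun heq => hx2 (Subtype.ext_iff.1 (hφ (Subtype.ext heq)))
  · exact fun heq => hx3 (Subtype.ext_iff.1 (hφ (Subtype.ext heq))).symm

theorem exists_three_points (l : Γ.Ln) :
    ∃ a b c, Γ.I a l ∧ Γ.I b l ∧ Γ.I c l ∧ a ≠ b ∧ a ≠ c ∧ b ≠ c := by
  obtain ⟨a | _, b | _, c | _, ha, hb, hc, hab, hac, hbc⟩ := h.exists_three_adj (.inr l)
  all_goals first | exact ha.elim | exact hb.elim | exact hc.elim | skip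
  exact ⟨a, b, c, ha, hb, hc, by simpa using hab, by simpa using hac, by simpa using hbc⟩

theorem exists_three_lines (p : Γ.Pt) :
    ∃ a b c, Γ.I p a ∧ Γ.I p b ∧ Γ.I p c ∧ a ≠ b ∧ a ≠ c ∧ b ≠ c :=
  h.dual.exists_three_points p

/-- If all lines are finite, then they have bounded size. -/
theorem exists_ncard_le (hfin : ∀ l, {p | Γ.I p l}.Finite):
    ∃ B, ∀ l, {p | Γ.I p l}.ncard ≤ B := by
  obtain ⟨A⟩ := h.exists_big_gon
  have hn := h.three_le
  have hset : ∀ l, Γ.incGraph.neighborSet (.inr l) = Sum.inl '' {p | Γ.I p l} := by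
    intro l
    ext (p | m)
    · simp [incGraph]
    · simp [incGraph]
  have hset' : ∀ p, Γ.incGraph.neighborSet (.inl p) = Sum.inr '' {l | Γ.I p l} := by
    intro p
    ext (p | m)
    · simp [incGraph]
    · simp [incGraph]
  -- An infinite neighbourhood contributes `ncard` zero to this sum, which is harmless: the summand
  -- used for l belongs to an element opposite to l, whose neighbourhood injects into the finite one
  -- of l.
  refine ⟨∑ i ∈ Finset.range (2 * (n + 1)), (Γ.incGraph.neighborSet (A.elt i)).ncard, fun l => ?_⟩
  obtain ⟨i, hi, hd⟩ := h.exists_opposite_elt A (by omega) (.inr l)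
  obtain ⟨φ, hφ⟩ := h.exists_injective_of_opposite hd
  obtain ⟨ψ, hψ⟩ := h.exists_injective_of_opposite ((SimpleGraph.dist_comm).trans hd)
  have hfl : (Γ.incGraph.neighborSet (.inr l)).Finite := by
    rw [hset]; exact (hfin l).image _
  have := hfl.to_subtype
  have hfe : (Γ.incGraph.neighborSet (A.elt i)).Finite := by
    have := Finite.of_injective ψ hψ
    exact Set.toFinite _
  have := hfe.to_subtype
  calc {p | Γ.I p l}.ncard = (Γ.incGraph.neighborSet (.inr l)).ncard := by
        rw [hset, Set.ncard_image_of_injective _ Sum.inl_injective]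
    _ ≤ (Γ.incGraph.neighborSet (A.elt i)).ncard := Nat.card_le_card_of_injective φ hφ
    _ ≤ _ := Finset.single_le_sum (f := fun i => (Γ.incGraph.neighborSet (A.elt i)).ncard)
        (fun _ _ => Nat.zero_le _) (Finset.mem_range.2 hi)

end IsGeneralizedNGon

end IncGeom

/-! ### The limit ultrapower and its shift. -/

section LimitPower

open Filter

namespace LimitPower

/-- A function of a sequence of naturals that depends on finitely many terms. -/
def FinDep {X : Sort*} (f : (ℕ → ℕ) → X) : Prop :=
  ∃ k, ∀ w w' : ℕ → ℕ, (∀ i < k, w i = w' i) → f w = f w'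

theorem FinDep.const {X : Sort*} (a : X) : FinDep fun _ => a := ⟨0, fun _ _ _ => rfl⟩

theorem FinDep.comp {X Y : Sort*} {f : (ℕ → ℕ) → X} (hf : FinDep f) (g : X → Y) :
    FinDep fun w => g (f w) := by
  obtain ⟨k, hk⟩ := hf
  exact ⟨k, fun w w' h => congrArg g (hk w w' h)⟩

theorem FinDep.comp₂ {X Y Z : Sort*} {f : (ℕ → ℕ) → X} {g : (ℕ → ℕ) → Y} (hf : FinDep f)
    (hg : FinDep g) (F : X → Y → Z) : FinDep fun w => F (f w) (g w) := by
  obtain ⟨k, hk⟩ := hf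
  obtain ⟨m, hm⟩ := hg
  refine ⟨max k m, fun w w' h => ?_⟩
  dsimp only
  rw [hk w w' fun i hi => h i (lt_max_of_lt_left hi), hm w w' fun i hi => h i (lt_max_of_lt_right hi)]

/-- Dropping the first term of a sequence. -/
def shift (w : ℕ → ℕ) : ℕ → ℕ := fun n => w (n + 1)

/-- Prepending a term to a sequence. -/
def cons (i : ℕ) (w : ℕ → ℕ) : ℕ → ℕ
  | 0 => i
  | n + 1 => w n

theorem FinDep.shift {X : Sort*} {f : (ℕ → ℕ) → X} (hf : FinDep f) :
    FinDep fun w => f (shift w) := by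
  obtain ⟨k, hk⟩ := hf
  exact ⟨k + 1, fun w w' h => hk _ _ fun i hi => h (i + 1) (by omega)⟩

/-- The iterated products of a nonprincipal ultrafilter on the naturals. -/
noncomputable def iterUltra : ℕ → Ultrafilter (ℕ → ℕ)
  | 0 => pure 0
  | n + 1 => (hyperfilter ℕ).bind fun i => (iterUltra n).map (cons i)

theorem eventually_iterUltra_succ {n : ℕ} {P : (ℕ → ℕ) → Prop} :
    (∀ᶠ w in (iterUltra (n + 1) : Filter (ℕ → ℕ)), P w) ↔
      ∀ᶠ i in (hyperfilter ℕ : Filter ℕ), ∀ᶠ w in (iterUltra n : Filter (ℕ → ℕ)), P (cons i w) :=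
  Iff.rfl

/-- An ultrafilter extending all iterated products. -/
noncomputable def limUltra : Ultrafilter (ℕ → ℕ) := (hyperfilter ℕ).bind iterUltra

theorem eventually_limUltra {P : (ℕ → ℕ) → Prop} :
    (∀ᶠ w in (limUltra : Filter (ℕ → ℕ)), P w) ↔
      ∀ᶠ n in (hyperfilter ℕ : Filter ℕ), ∀ᶠ w in (iterUltra n : Filter (ℕ → ℕ)), P w :=
  Iff.rfl

/-- The iterated products are compatible: peeling off first terms, one is left after k steps with a
condition that no longer depends on the sequence. -/
theorem eventually_iterUltra_iff {k : ℕ} : ∀ {P : (ℕ → ℕ) → Prop},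
    (∀ w w' : ℕ → ℕ, (∀ i < k, w i = w' i) → P w = P w') → ∀ n, k ≤ n →
      ((∀ᶠ w in (iterUltra n : Filter (ℕ → ℕ)), P w) ↔
        ∀ᶠ w in (iterUltra k : Filter (ℕ → ℕ)), P w) := by
  induction k with
  | zero =>
    intro P hP n _
    have : P = fun _ => P 0 := funext fun w => hP w 0 (by simp)
    rw [this]
    simp
  | succ k ih =>
    intro P hP n hn
    obtain ⟨m, rfl⟩ : ∃ m, n = m + 1 := ⟨n - 1, by omega⟩
    rw [eventually_iterUltra_succ, eventually_iterUltra_succ]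
    refine eventually_congr (Eventually.of_forall fun i => ih (fun w w' h => hP _ _ ?_) m (by omega))
    rintro (_ | j) hj
    · rfl
    · exact h j (by omega)

theorem eventually_hyperfilter_ge (k : ℕ) : ∀ᶠ n in (hyperfilter ℕ : Filter ℕ), k ≤ n :=
  (Nat.cofinite_eq_atTop ▸ hyperfilter_le_cofinite : (hyperfilter ℕ : Filter ℕ) ≤ atTop)
    (eventually_ge_atTop k)

theorem eventually_limUltra_iff {k : ℕ} {P : (ℕ → ℕ) → Prop}
    (hP : ∀ w w' : ℕ → ℕ, (∀ i < k, w i = w' i) → P w = P w') :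
    (∀ᶠ w in (limUltra : Filter (ℕ → ℕ)), P w) ↔
      ∀ᶠ w in (iterUltra k : Filter (ℕ → ℕ)), P w := by
  rw [eventually_limUltra, eventually_congr ((eventually_hyperfilter_ge k).mono
    fun n hn => eventually_iterUltra_iff hP n hn)]
  simp

/-- Self-similarity of the measure. Finite dependence replaces the limit by the products at levels k
+ 1 and k, which differ by one initial factor. -/
theorem eventually_limUltra_cons {P : (ℕ → ℕ) → Prop} (hP : FinDep P) :
    (∀ᶠ w in (limUltra : Filter (ℕ → ℕ)), P w) ↔
      ∀ᶠ i in (hyperfilter ℕ : Filter ℕ), ∀ᶠ w in (limUltra : Filter (ℕ → ℕ)), P (cons i w) := by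
  obtain ⟨k, hk⟩ := hP
  have hk' : ∀ w w' : ℕ → ℕ, (∀ i < k + 1, w i = w' i) → P w = P w' :=
    fun w w' h => hk w w' fun i hi => h i (by omega)
  rw [eventually_limUltra_iff hk', eventually_iterUltra_succ]
  refine eventually_congr (Eventually.of_forall fun i => (eventually_limUltra_iff ?_).symm)
  intro w w' h
  refine hk' _ _ ?_
  rintro (_ | j) hj
  · rfl
  · exact h j (by omega)

theorem eventually_limUltra_shift {P : (ℕ → ℕ) → Prop} (hP : FinDep P) :
    (∀ᶠ w in (limUltra : Filter (ℕ → ℕ)), P (shift w)) ↔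
      ∀ᶠ w in (limUltra : Filter (ℕ → ℕ)), P w := by
  rw [eventually_limUltra_cons hP.shift]
  have : ∀ i w, shift (cons i w) = w := fun _ _ => rfl
  simp [this]

/-- Equality almost everywhere of functions depending on finitely many terms. -/
def setoid (X : Type u) : Setoid {f : (ℕ → ℕ) → X // FinDep f} where
  r f g := ∀ᶠ w in (limUltra : Filter (ℕ → ℕ)), f.1 w = g.1 w
  iseqv := ⟨fun _ => Eventually.of_forall fun _ => rfl, fun h => h.mono fun _ => Eq.symm,
    fun h h' => (h.and h').mono fun _ hw => hw.1.trans hw.2⟩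

end LimitPower

open LimitPower

/-- The limit ultrapower of a type along the iterated products of an ultrafilter. -/
def LimitPower (X : Type u) : Type u := Quotient (setoid X)

namespace LimitPower

variable {X Y : Type u}

/-- The class of a function. -/
def germ (f : (ℕ → ℕ) → X) (hf : FinDep f) : LimitPower X := Quotient.mk (setoid X) ⟨f, hf⟩

theorem germ_eq_germ {f g : (ℕ → ℕ) → X} {hf : FinDep f} {hg : FinDep g} :
    germ f hf = germ g hg ↔ ∀ᶠ w in (limUltra : Filter (ℕ → ℕ)), f w = g w :=
  Quotient.eq (r := setoid X)

/-- A representative. -/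
noncomputable def rep (a : LimitPower X) : (ℕ → ℕ) → X := (Quotient.out a).1

theorem finDep_rep (a : LimitPower X) : FinDep a.rep := (Quotient.out a).2

@[simp] theorem germ_rep (a : LimitPower X) : germ a.rep a.finDep_rep = a := Quotient.out_eq a

theorem rep_germ {f : (ℕ → ℕ) → X} (hf : FinDep f) :
    ∀ᶠ w in (limUltra : Filter (ℕ → ℕ)), (germ f hf).rep w = f w :=
  germ_eq_germ.1 (germ_rep (germ f hf))

theorem eq_iff {a b : LimitPower X} :
    a = b ↔ ∀ᶠ w in (limUltra : Filter (ℕ → ℕ)), a.rep w = b.rep w := by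
  rw [← germ_eq_germ (hf := a.finDep_rep) (hg := b.finDep_rep), germ_rep, germ_rep]

theorem ne_iff {a b : LimitPower X} :
    a ≠ b ↔ ∀ᶠ w in (limUltra : Filter (ℕ → ℕ)), a.rep w ≠ b.rep w := by
  rw [Ne, eq_iff]
  exact Ultrafilter.eventually_not.symm

/-- The map induced by the shift. -/
noncomputable def push (a : LimitPower X) : LimitPower X :=
  germ (fun w => a.rep (shift w)) a.finDep_rep.shift

theorem push_injective : Function.Injective (push : LimitPower X → LimitPower X) := by
  intro a b h
  rw [push, push, germ_eq_germ] at h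
  exact eq_iff.2 ((eventually_limUltra_shift (a.finDep_rep.comp₂ b.finDep_rep Eq)).1 h)

theorem push_const (a : X) : push (germ (fun _ => a) (.const a)) = germ (fun _ => a) (.const a) := by
  rw [push, germ_eq_germ]
  exact (eventually_limUltra_shift ((finDep_rep _).comp (· = a))).2 (rep_germ (.const a))

/-- The class of an injective function of the first term has no preimage: a shifted function ignores
the first term, so its representative would have to equal `e i` almost everywhere for two different
i. -/
theorem not_surjective_push [Infinite X] :
    ¬ Function.Surjective (push : LimitPower X → LimitPower X) := by
  intro hs
  let e := Infinite.natEmbedding X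
  have hd : FinDep fun w : ℕ → ℕ => e (w 0) := ⟨1, fun w w' h => by dsimp only; rw [h 0 one_pos]⟩
  obtain ⟨b, hb⟩ := hs (germ _ hd)
  rw [push, germ_eq_germ, eventually_limUltra_cons (b.finDep_rep.shift.comp₂ hd Eq)] at hb
  have hb' : ∀ᶠ i in (hyperfilter ℕ : Filter ℕ),
      ∀ᶠ w in (limUltra : Filter (ℕ → ℕ)), b.rep w = e i := hb
  obtain ⟨i, hi⟩ := hb'.exists
  obtain ⟨j, hj, hij⟩ := (hb'.and (eventually_hyperfilter_ge (i + 1))).exists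
  obtain ⟨w, hw, hw'⟩ := (hi.and hj).exists
  have := e.injective (hw.symm.trans hw')
  omega

end LimitPower

/-! ### Limit ultrapowers of generalized polygons. -/

namespace IncGeom

variable {Γ : IncGeom.{u}} {n k : ℕ}

/-- The limit ultrapower of a geometry. -/
noncomputable def limitPower (Γ : IncGeom.{u}) : IncGeom.{u} where
  Pt := LimitPower Γ.Pt
  Ln := LimitPower Γ.Ln
  I p l := ∀ᶠ w in (limUltra : Filter (ℕ → ℕ)), Γ.I (p.rep w) (l.rep w)

theorem limitPower_I_germ {f : (ℕ → ℕ) → Γ.Pt} {g : (ℕ → ℕ) → Γ.Ln} {hf : FinDep f}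
    {hg : FinDep g} : Γ.limitPower.I (germ f hf) (germ g hg) ↔
      ∀ᶠ w in (limUltra : Filter (ℕ → ℕ)), Γ.I (f w) (g w) :=
  eventually_congr (((rep_germ hf).and (rep_germ hg)).mono fun w hw => by rw [hw.1, hw.2])

/-- The shift endomorphism of the limit ultrapower. -/
noncomputable def limitPowerShift (Γ : IncGeom.{u}) : Γ.limitPower.Hom Γ.limitPower where
  onPt := push
  onLn := push
  inc p l h := limitPower_I_germ.2
    ((eventually_limUltra_shift (p.finDep_rep.comp₂ l.finDep_rep Γ.I)).2 h)

/-- The coordinate of an element of the limit ultrapower. -/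
noncomputable def limitPowerCoord (e : Γ.limitPower.Elt) (w : ℕ → ℕ) : Γ.Elt :=
  e.map (fun p => LimitPower.rep p w) fun l => LimitPower.rep l w

theorem finDep_limitPowerCoord (e : Γ.limitPower.Elt) : FinDep (limitPowerCoord e) := by
  rcases e with p | l
  · exact (finDep_rep p).comp Sum.inl
  · exact (finDep_rep l).comp Sum.inr

/-- An ultrafilter decides finite disjunctions; this is how vertices of polygons and points of
bounded lines get a fixed index. -/
theorem eventually_exists_finite {ι : Type*} [Finite ι] {P : ι → (ℕ → ℕ) → Prop}
    (h : ∀ᶠ w in (limUltra : Filter (ℕ → ℕ)), ∃ i, P i w) :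
    ∃ i, ∀ᶠ w in (limUltra : Filter (ℕ → ℕ)), P i w := by
  by_contra hcon
  have h' : ∀ᶠ w in (limUltra : Filter (ℕ → ℕ)), ∀ i, ¬ P i w :=
    eventually_all.2 fun i => Ultrafilter.eventually_not.2 fun hi => hcon ⟨i, hi⟩
  obtain ⟨w, ⟨i, hi⟩, hw⟩ := (h.and h').exists
  exact hw i hi

/-- The ordinary polygon in the limit ultrapower defined by a family of ordinary polygons. -/
noncomputable def OrdinaryGon.limitPower (A : (ℕ → ℕ) → Γ.OrdinaryGon k) (hA : FinDep A) :
    Γ.limitPower.OrdinaryGon k where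
  p i := germ (fun w => (A w).p i) (hA.comp fun B => B.p i)
  l i := germ (fun w => (A w).l i) (hA.comp fun B => B.l i)
  p_injective i j h := by
    obtain ⟨w, hw⟩ := (germ_eq_germ.1 h).exists
    exact (A w).p_injective hw
  l_injective i j h := by
    obtain ⟨w, hw⟩ := (germ_eq_germ.1 h).exists
    exact (A w).l_injective hw
  inc_left i := limitPower_I_germ.2 (Eventually.of_forall fun w => (A w).inc_left i)
  inc_right i := limitPower_I_germ.2 (Eventually.of_forall fun w => (A w).inc_right i)

theorem OrdinaryGon.limitPower_contains [NeZero k] {A : (ℕ → ℕ) → Γ.OrdinaryGon k} {hA : FinDep A}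
    {e : Γ.limitPower.Elt} (he : ∀ w, (A w).Contains (limitPowerCoord e w)) :
    (OrdinaryGon.limitPower A hA).Contains e := by
  rcases e with p | l
  · obtain ⟨i, hi⟩ := eventually_exists_finite (P := fun i w => (A w).p i = LimitPower.rep p w)
      (Eventually.of_forall he)
    exact ⟨i, (germ_eq_germ.2 hi).trans (germ_rep p)⟩
  · obtain ⟨i, hi⟩ := eventually_exists_finite (P := fun i w => (A w).l i = LimitPower.rep l w)
      (Eventually.of_forall he)
    exact ⟨i, (germ_eq_germ.2 hi).trans (germ_rep l)⟩

/-- For k ≠ 0 a k-gon is described by finitely many incidences and inequalities, which hold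
simultaneously at some coordinate. -/
theorem isEmpty_limitPower_ordinaryGon [NeZero k] (h : IsEmpty (Γ.OrdinaryGon k)) :
    IsEmpty (Γ.limitPower.OrdinaryGon k) := by
  refine ⟨fun A => ?_⟩
  have hinj : ∀ {X : Type u} (f : ZMod k → LimitPower X), Function.Injective f →
      ∀ᶠ w in (limUltra : Filter (ℕ → ℕ)), Function.Injective fun i => (f i).rep w := by
    intro X f hf
    have : ∀ᶠ w in (limUltra : Filter (ℕ → ℕ)), ∀ i j, i ≠ j → (f i).rep w ≠ (f j).rep w := by
      simp only [eventually_all]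
      exact fun i j hij => LimitPower.ne_iff.1 fun he => hij (hf he)
    exact this.mono fun w hw i j hij => by_contra fun hne => hw i j hne hij
  have h1 := hinj A.p A.p_injective
  have h2 := hinj A.l A.l_injective
  have h3 : ∀ᶠ w in (limUltra : Filter (ℕ → ℕ)), ∀ i, Γ.I ((A.p i).rep w) ((A.l i).rep w) :=
    eventually_all.2 A.inc_left
  have h4 : ∀ᶠ w in (limUltra : Filter (ℕ → ℕ)), ∀ i, Γ.I ((A.p (i + 1)).rep w) ((A.l i).rep w) :=
    eventually_all.2 A.inc_right
  obtain ⟨w, ⟨hw1, hw2⟩, hw3, hw4⟩ := ((h1.and h2).and (h3.and h4)).exists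
  exact h.false ⟨fun i => (A.p i).rep w, fun i => (A.l i).rep w, hw1, hw2, hw3, hw4⟩

theorem IsGeneralizedNGon.limitPower (h : Γ.IsGeneralizedNGon n) :
    Γ.limitPower.IsGeneralizedNGon n where
  three_le := h.three_le
  no_small_gon k h2 hk := by
    have : NeZero k := ⟨by omega⟩
    exact isEmpty_limitPower_ordinaryGon (h.no_small_gon k h2 hk)
  exists_gon e f := by
    have : NeZero n := ⟨by have := h.three_le; omega⟩
    -- One n-gon is chosen for each pair of elements, not for each sequence, so that the family
    -- still depends on finitely many terms.
    choose A hA hA' using h.exists_gon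
    exact ⟨OrdinaryGon.limitPower (fun w => A (limitPowerCoord e w) (limitPowerCoord f w))
      ((finDep_limitPowerCoord e).comp₂ (finDep_limitPowerCoord f) A),
      OrdinaryGon.limitPower_contains fun w => hA _ _,
      OrdinaryGon.limitPower_contains fun w => hA' _ _⟩
  exists_big_gon := h.exists_big_gon.map fun A => OrdinaryGon.limitPower (fun _ => A) (.const A)

theorem infinite_lines_limitPower (hinf : ∀ p, {l | Γ.I p l}.Infinite) (p : Γ.limitPower.Pt) :
    {l | Γ.limitPower.I p l}.Infinite := by
  let e := fun p => (hinf p).natEmbedding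
  refine Set.infinite_of_injective_forall_mem
    (f := fun k => germ (fun w => (e (LimitPower.rep p w) k : Γ.Ln))
      ((finDep_rep p).comp fun q => (e q k : Γ.Ln))) (fun i j hij => ?_) fun k => ?_
  · obtain ⟨w, hw⟩ := (germ_eq_germ.1 hij).exists
    exact (e _).injective (Subtype.ext hw)
  · refine (rep_germ ((finDep_rep p).comp fun q => (e q k : Γ.Ln))).mono fun w hw => ?_
    exact hw ▸ (e (LimitPower.rep p w) k).2

/-- A common index set for all lines, obtained by padding with a point of the line, is what allows
the ultrafilter to select a single index. -/
theorem exists_enumeration {B : ℕ} (hfin : ∀ l, {p | Γ.I p l}.Finite)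
    (hne : ∀ l, {p | Γ.I p l}.Nonempty) (hB : ∀ l, {p | Γ.I p l}.ncard ≤ B) :
    ∃ g : Γ.Ln → Fin B → Γ.Pt, ∀ p l, Γ.I p l → ∃ j, g l j = p := by
  have key : ∀ l, ∃ g : Fin B → Γ.Pt, ∀ p, Γ.I p l → ∃ j, g j = p := by
    intro l
    obtain ⟨p₀, hp₀⟩ := hne l
    have := (hfin l).fintype
    let e := (hfin l).toFinset.equivFin
    have hc : (hfin l).toFinset.card ≤ B := by
      rw [← Set.ncard_eq_toFinset_card _ (hfin l)]; exact hB l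
    refine ⟨fun j => if hj : j.1 < (hfin l).toFinset.card then e.symm ⟨j, hj⟩ else p₀,
      fun p hp => ?_⟩
    have hp' : p ∈ (hfin l).toFinset := (hfin l).mem_toFinset.2 hp
    refine ⟨⟨e ⟨p, hp'⟩, (e ⟨p, hp'⟩).2.trans_le hc⟩, ?_⟩
    dsimp only
    rw [dif_pos (e ⟨p, hp'⟩).2, Fin.eta, e.symm_apply_apply]
  choose g hg using key
  exact ⟨g, fun p l h => hg l p h⟩

theorem exists_eq_germ_of_limitPower_I {B : ℕ} {g : Γ.Ln → Fin B → Γ.Pt}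
    (hg : ∀ p l, Γ.I p l → ∃ j, g l j = p) {p : Γ.limitPower.Pt} {l : Γ.limitPower.Ln}
    (h : Γ.limitPower.I p l) :
    ∃ j, p = germ (fun w => g (LimitPower.rep l w) j) ((finDep_rep l).comp fun m => g m j) := by
  obtain ⟨j, hj⟩ := eventually_exists_finite
    (P := fun j w => g (LimitPower.rep l w) j = LimitPower.rep p w)
    (h.mono fun w hw => hg _ _ hw)
  exact ⟨j, ((germ_eq_germ.2 hj).trans (germ_rep p)).symm⟩

/-- A generalized polygon with finite lines and infinitely many lines on each point yields a locally
finite object of the category. -/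
theorem exists_catE_of_finite_lines (h : Γ.IsGeneralizedPolygon)
    (hfin : ∀ l, {p | Γ.I p l}.Finite) (hinf : ∀ p, {l | Γ.I p l}.Infinite) :
    ∃ A : CatE.{u}, A.X.Γ.IsLocallyFinite := by
  obtain ⟨n, h⟩ := h
  obtain ⟨B, hB⟩ := h.exists_ncard_le hfin
  have hne : ∀ l, {p | Γ.I p l}.Nonempty := fun l => by
    obtain ⟨a, _, _, ha, _⟩ := h.exists_three_points l
    exact ⟨a, ha⟩
  obtain ⟨g, hg⟩ := exists_enumeration hfin hne hB
  obtain ⟨C⟩ := h.exists_big_gon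
  have : Infinite Γ.Ln := (Set.infinite_univ_iff).1 ((hinf (C.p 0)).mono (Set.subset_univ _))
  refine ⟨⟨⟨Γ.limitPower, ⟨n, h.limitPower⟩, .inr (germ (fun _ => C.l 0) (.const _))⟩,
    Γ.limitPowerShift, ⟨push_const _, fun p hp => ?_⟩,
    Sum.map_injective.2 ⟨push_injective, push_injective⟩, fun hb => ?_⟩,
    Or.inl ⟨fun l => ?_, infinite_lines_limitPower hinf⟩⟩
  -- A point of the constant base line is its j-th point for a fixed j, hence constant and fixed by
  -- the shift.
  · obtain ⟨j, hj⟩ := exists_eq_germ_of_limitPower_I hg hp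
    have hj' : p = germ (fun _ => g (C.l 0) j) (.const _) :=
      hj.trans (germ_eq_germ.2 ((rep_germ (.const (C.l 0))).mono fun w hw => by rw [hw]))
    rw [hj']
    exact push_const _
  · exact not_surjective_push (Sum.map_surjective.1 hb.2).2
  · exact (Set.finite_range _).subset fun p hp => by
      obtain ⟨j, hj⟩ := exists_eq_germ_of_limitPower_I hg hp
      exact ⟨j, hj.symm⟩

theorem exists_catE_of_isLocallyFinite (h : Γ.IsGeneralizedPolygon) (hf : Γ.IsLocallyFinite) :
    ∃ A : CatE.{u}, A.X.Γ.IsLocallyFinite := by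
  rcases hf with ⟨h1, h2⟩ | ⟨h1, h2⟩
  · exact exists_catE_of_finite_lines h h1 h2
  · obtain ⟨n, h⟩ := h
    exact exists_catE_of_finite_lines (Γ := Γ.dual) ⟨n, h.dual⟩ h1 h2

end IncGeom

end LimitPower

/-! ### Abelian groups with a translation family, and their kernel endomorphisms. -/

/-- A family of subgroups `A i ≤ S i` of an abelian group, as given by the stabilizers of the lines
on an affine point of a translation quadrangle and of their points collinear with the translation
point. -/
structure IsTranslationFamily {G ι : Type*} [AddCommGroup G] (A S : ι → AddSubgroup G) : Prop where
  le : ∀ i, A i ≤ S i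
  disjoint : ∀ {i j}, i ≠ j → ∀ {x}, x ∈ S i → x ∈ A j → x = 0
  cover : ∀ i w, w ∉ S i → ∃ a ∈ A i, ∃ m, m ≠ i ∧ ∃ d ∈ A m, w = a + d
  indep : ∀ {i j k}, i ≠ j → i ≠ k → j ≠ k → ∀ {a b c}, a ∈ A i → b ∈ A j → c ∈ A k →
    a + b + c = 0 → a = 0
  exists_ne_zero : ∀ i, ∃ a ∈ A i, a ≠ 0
  exists_three : ∃ i j k : ι, i ≠ j ∧ i ≠ k ∧ j ≠ k
  compl : ∀ {k j}, k ≠ j → ∀ w, ∃ c ∈ A j, w - c ∈ S k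

namespace IsTranslationFamily

variable {G ι : Type*} [AddCommGroup G] {A S : ι → AddSubgroup G} (h : IsTranslationFamily A S)
include h

theorem exists_third (i j : ι) : ∃ k, k ≠ i ∧ k ≠ j := by
  obtain ⟨a, b, c, hab, hac, hbc⟩ := h.exists_three
  by_cases ha : a ≠ i ∧ a ≠ j
  · exact ⟨a, ha⟩
  by_cases hb : b ≠ i ∧ b ≠ j
  · exact ⟨b, hb⟩
  refine ⟨c, ?_, ?_⟩ <;> rintro rfl <;> simp_all

theorem exists_other (i : ι) : ∃ k, k ≠ i := (h.exists_third i i).imp fun _ => And.left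

theorem eq_zero_of_mem {i j : ι} (hij : i ≠ j) {x : G} (hi : x ∈ A i) (hj : x ∈ A j) : x = 0 :=
  h.disjoint hij (h.le i hi) hj

section Endomorphism

variable {α : G →+ G} (hα : ∀ i, ∀ x ∈ A i, α x ∈ A i)
include hα

/-- Write a - c = b + d by `cover` and apply α, which kills a. If d lies in a component other than
i, j and k, independence kills α c; for component j or i, independence before applying α gives a = 0
or c = 0. -/
theorem map_eq_zero {i j k : ι} (hij : i ≠ j) (hik : i ≠ k) (hjk : j ≠ k) {a c : G} (ha : a ∈ A i)
    (ha0 : a ≠ 0) (hαa : α a = 0) (hc : c ∈ A j) (hac : a - c ∉ S k) : α c = 0 := by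
  obtain ⟨b, hb, m, hmk, d, hd, hw⟩ := h.cover k _ hac
  have h1 : α c + α b + α d = 0 := by
    have := congrArg α hw
    rw [map_sub, map_add, hαa] at this
    rw [add_assoc, ← this]; abel
  by_cases hmj : m = j
  · subst hmj
    have : a = 0 := h.indep hij hik hjk ha (neg_mem (add_mem hc hd)) (neg_mem hb) (by
      rw [sub_eq_iff_eq_add.1 hw]; abel)
    exact (ha0 this).elim
  · by_cases hmi : m = i
    · subst hmi
      have : c = 0 := h.indep (Ne.symm hij) hjk hik hc (sub_mem hd ha) hb (by
        rw [sub_eq_iff_eq_add.1 hw]; abel)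
      rw [this, map_zero]
    · exact h.indep hjk (Ne.symm hmj) (Ne.symm hmk) (hα _ _ hc) (hα _ _ hb) (hα _ _ hd) h1

/-- If an endomorphism kills a nonzero element of a component but not all of another component,
then every component has order two. -/
theorem eq_of_ne_zero {i j : ι} (hij : i ≠ j) {a c : G} (ha : a ∈ A i) (ha0 : a ≠ 0)
    (hαa : α a = 0) (hc : c ∈ A j) (hαc : α c ≠ 0) (m : ι) {x y : G} (hx : x ∈ A m) (hy : y ∈ A m)
    (hx0 : x ≠ 0) (hy0 : y ≠ 0) : x = y := by
  -- Elements z of `A j` not killed by α satisfy a - z ∈ S k, so any two of them differ by an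
  -- element of S k ∩ A j = 0. A nonzero x killed by α would make c + x a second one.
  have key : ∀ x ∈ A j, x ≠ 0 → x = c := by
    intro x hx hx0
    obtain ⟨k, hki, hkj⟩ := h.exists_third i j
    have mem : ∀ z ∈ A j, α z ≠ 0 → a - z ∈ S k := fun z hz hαz => by
      by_contra hcon
      exact hαz (h.map_eq_zero hα hij hki.symm hkj.symm ha ha0 hαa hz hcon)
    have eq : ∀ z ∈ A j, α z ≠ 0 → z = c := fun z hz hαz => by
      have := sub_mem (mem c hc hαc) (mem z hz hαz)
      rw [sub_sub_sub_cancel_left] at this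
      exact sub_eq_zero.1 (h.disjoint hkj this (sub_mem hz hc))
    by_cases hαx : α x = 0
    · have hαcx : α (c + x) ≠ 0 := by rwa [map_add, hαx, add_zero]
      exact (hx0 (by simpa using eq (c + x) (add_mem hc hx) hαcx)).elim
    · exact eq x hx hαx
  by_cases hmj : m = j
  · subst hmj
    rw [key x hx hx0, key y hy hy0]
  · obtain ⟨k, hkj, hkm⟩ := h.exists_third j m
    -- `A j` represents all cosets of `S k` and has c as its only nonzero element, so a nonzero x in
    -- `A m`, lying outside `S k`, is congruent to c.
    have mem : ∀ x ∈ A m, x ≠ 0 → x - c ∈ S k := fun x hx hx0 => by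
      obtain ⟨c', hc', hxc⟩ := h.compl hkj x
      by_cases h0 : c' = 0
      · rw [h0, sub_zero] at hxc
        exact (hx0 (h.disjoint hkm hxc hx)).elim
      · rwa [key c' hc' h0] at hxc
    have := sub_mem (mem x hx hx0) (mem y hy hy0)
    rw [sub_sub_sub_cancel_right] at this
    exact sub_eq_zero.1 (h.disjoint hkm this (sub_mem hx hy))

omit hα in
theorem eq_zero_of_forall_mem (h0 : ∀ i, ∀ x ∈ A i, α x = 0) : α = 0 := by
  obtain ⟨i, -⟩ := h.exists_three
  obtain ⟨j, hji⟩ := h.exists_other i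
  have key : ∀ w, w ∉ S i → α w = 0 := fun w hw => by
    obtain ⟨a, ha, m, -, d, hd, rfl⟩ := h.cover i w hw
    rw [map_add, h0 _ _ ha, h0 _ _ hd, add_zero]
  ext w
  by_cases hw : w ∈ S i
  · obtain ⟨c, hc, hc0⟩ := h.exists_ne_zero j
    -- Adding a nonzero element of another component moves w out of `S i`, where `cover` applies;
    -- the same device recurs below.
    have := key (w + c) fun hwc => hc0 (h.disjoint hji.symm (by simpa using sub_mem hwc hw) hc)
    rwa [map_add, h0 _ _ hc, add_zero] at this
  · exact key w hw

end Endomorphism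

section OrderTwo

variable (htwo : ∀ m, ∀ x ∈ A m, ∀ y ∈ A m, x ≠ 0 → y ≠ 0 → x = y)
  {t : ι → G} (ht : ∀ i, t i ∈ A i) (ht0 : ∀ i, t i ≠ 0)
include htwo ht ht0

omit h in
theorem eq_zero_or_eq {i : ι} {x : G} (hx : x ∈ A i) : x = 0 ∨ x = t i :=
  or_iff_not_imp_left.2 fun hx0 => htwo i x hx _ (ht i) hx0 (ht0 i)

omit h in
theorem neg_eq_self (i : ι) : -t i = t i :=
  htwo i _ (neg_mem (ht i)) _ (ht i) (neg_ne_zero.2 (ht0 i)) (ht0 i)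

theorem add_mem_of_ne {i j k : ι} (hik : i ≠ k) (hjk : j ≠ k) : t i + t j ∈ S k := by
  obtain ⟨c, hc, hw⟩ := h.compl hjk.symm (t i)
  rcases eq_zero_or_eq htwo ht ht0 hc with rfl | rfl
  · rw [sub_zero] at hw
    exact (ht0 i (h.disjoint hik.symm hw (ht i))).elim
  · rwa [sub_eq_add_neg, neg_eq_self htwo ht ht0] at hw

theorem add_four_ne_zero {i j k m : ι} (hik : i ≠ k) (hjk : j ≠ k) (hmk : m ≠ k) :
    t i + t j + t k + t m ≠ 0 := by
  intro h0
  have h1 := h.add_mem_of_ne htwo ht ht0 hik hjk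
  have h2 : t m = -(t i + t j) - t k := by
    rw [eq_sub_iff_add_eq, eq_neg_iff_add_eq_zero, ← h0]; abel
  exact ht0 m (h.disjoint hmk.symm (h2 ▸ sub_mem (neg_mem h1) (h.le _ (ht k))) (ht m))

omit htwo in
theorem add_three_ne_zero {i j k : ι} (hij : i ≠ j) (hik : i ≠ k) (hjk : j ≠ k) :
    t i + t j + t k ≠ 0 := fun h0 => ht0 i (h.indep hij hik hjk (ht i) (ht j) (ht k) h0)

omit htwo in
theorem add_two_ne_zero {i j : ι} (hij : i ≠ j) : t i + t j ≠ 0 := fun h0 =>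
  ht0 i (h.eq_zero_of_mem hij (ht i) (by rw [eq_neg_of_add_eq_zero_left h0]; exact neg_mem (ht j)))

/-- The sum of the first three lies outside `S m`, so `cover` writes it as an element of `A m` plus
some t r. Short relations among the t's are impossible, which forces the former to be t m and r to
be new. -/
theorem exists_fifth {i j k m : ι} (hij : i ≠ j) (hik : i ≠ k) (hjk : j ≠ k) (him : i ≠ m)
    (hjm : j ≠ m) (hkm : k ≠ m) :
    ∃ r, r ≠ i ∧ r ≠ j ∧ r ≠ k ∧ r ≠ m ∧ t i + t j + t k + t m + t r = 0 := by
  have hS : t i + t j + t k ∉ S m := fun hmem => by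
    have := sub_mem hmem (h.add_mem_of_ne htwo ht ht0 him hjm)
    rw [add_sub_cancel_left] at this
    exact ht0 k (h.disjoint hkm.symm this (ht k))
  obtain ⟨a, ha, r, hrm, d, hd, hw⟩ := h.cover m _ hS
  have hneg := neg_eq_self htwo ht ht0
  have h3 := @add_three_ne_zero _ _ _ _ _ h t ht ht0
  have h2 := @add_two_ne_zero _ _ _ _ _ h t ht ht0
  rcases eq_zero_or_eq htwo ht ht0 hd with rfl | rfl
  · rw [add_zero] at hw
    exact (hS (hw ▸ h.le _ ha)).elim
  have hsum : t i + t j + t k - t r = a := by rw [hw]; abel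
  have hdbl : ∀ i, t i + t i = 0 := fun i => by nth_rewrite 1 [← hneg i]; exact neg_add_cancel _
  rcases eq_zero_or_eq htwo ht ht0 ha with rfl | rfl
  · by_cases hri : r = i
    · subst hri
      exact (h2 hjk (by rw [← hsum]; abel)).elim
    by_cases hrj : r = j
    · subst hrj
      exact (h2 hik (by rw [← hsum]; abel)).elim
    by_cases hrk : r = k
    · subst hrk
      exact (h2 hij (by rw [← hsum]; abel)).elim
    refine (h.add_four_ne_zero htwo ht ht0 (i := i) (j := j) (k := k) (m := r) hik hjk hrk ?_).elim
    rw [← hneg r, ← sub_eq_add_neg, hsum]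
  · have hsum' : t i + t j + t k - t m - t r = 0 := by rw [hw]; abel
    have hsum2 : t i + t j + t k + t m + t r = 0 := by
      rw [sub_eq_add_neg, sub_eq_add_neg, hneg, hneg] at hsum'; exact hsum'
    refine ⟨r, ?_, ?_, ?_, hrm, hsum2⟩
    · rintro rfl
      refine h3 hjk hjm hkm ?_
      rw [← hsum2, ← sub_eq_zero, ← neg_eq_zero, ← hdbl r]; abel
    · rintro rfl
      refine h3 hik him hkm ?_
      rw [← hsum2, ← sub_eq_zero, ← neg_eq_zero, ← hdbl r]; abel
    · rintro rfl
      refine h3 hij him hjm ?_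
      rw [← hsum2, ← sub_eq_zero, ← neg_eq_zero, ← hdbl r]; abel

/-- On each t, α is zero or the identity. Applied to the five-term relation it leaves a vanishing
sum that contains t j but not t i: one to three terms cannot sum to zero, and four would give t i =
0. -/
theorem false_of_four {α : G →+ G} (hα : ∀ i, ∀ x ∈ A i, α x ∈ A i) {i j k m : ι} (hij : i ≠ j)
    (hik : i ≠ k) (hjk : j ≠ k) (him : i ≠ m) (hjm : j ≠ m) (hkm : k ≠ m) (hαi : α (t i) = 0)
    (hαj : α (t j) ≠ 0) : False := by
  obtain ⟨r, hri, hrj, hrk, hrm, h5⟩ := h.exists_fifth htwo ht ht0 hij hik hjk him hjm hkm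
  have h01 : ∀ i, α (t i) = 0 ∨ α (t i) = t i := fun i =>
    eq_zero_or_eq htwo ht ht0 (hα i _ (ht i))
  have h3 := @add_three_ne_zero _ _ _ _ _ h t ht ht0
  have h2 := @add_two_ne_zero _ _ _ _ _ h t ht ht0
  have h5α := congrArg α h5
  simp only [map_add, map_zero, hαi, zero_add] at h5α
  rw [(h01 j).resolve_left hαj] at h5α
  rcases h01 k with hk | hk <;> rcases h01 m with hm | hm <;> rcases h01 r with hr | hr <;>
    simp only [hk, hm, hr, add_zero] at h5α
  · exact ht0 j h5α
  · exact h2 hrj.symm h5α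
  · exact h2 hjm h5α
  · exact h3 hjm hrj.symm hrm.symm h5α
  · exact h2 hjk h5α
  · exact h3 hjk hrj.symm hrk.symm h5α
  · exact h3 hjk hjm hkm h5α
  · refine ht0 i ?_
    have : t i + (t j + t k + t m + t r) = 0 := by rw [← h5]; abel
    rwa [h5α, add_zero] at this

/-- The group is the direct sum of three subgroups of order two: independence gives injectivity of
the sum map, `cover` generation. -/
theorem card_eq_eight {i j k : ι} (hij : i ≠ j) (hik : i ≠ k) (hjk : j ≠ k)
    (hall : ∀ m, m = i ∨ m = j ∨ m = k) : Nat.card G = 8 := by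
  let f : ι → Bool → G := fun i b => if b then t i else 0
  have hf : ∀ i b, f i b ∈ A i := fun i b => by
    cases b
    · exact zero_mem _
    · exact ht i
  have hfinj : ∀ i b b', f i b = f i b' → b = b' := fun i b b' hb => by
    cases b <;> cases b' <;> simp_all [f, eq_comm]
  have hmem : ∀ {i x}, x ∈ A i → ∃ b, f i b = x := fun {i x} hx => by
    rcases eq_zero_or_eq htwo ht ht0 hx with rfl | rfl
    · exact ⟨false, rfl⟩
    · exact ⟨true, rfl⟩
  let F : Bool × Bool × Bool → G := fun b => f i b.1 + f j b.2.1 + f k b.2.2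
  have hF : Function.Bijective F := by
    constructor
    · rintro ⟨b1, b2, b3⟩ ⟨c1, c2, c3⟩ hbc
      have hsum : (f i b1 - f i c1) + (f j b2 - f j c2) + (f k b3 - f k c3) = 0 := by
        have : F (b1, b2, b3) - F (c1, c2, c3) = 0 := sub_eq_zero.2 hbc
        rw [← this]; simp only [F]; abel
      have m1 := sub_mem (hf i b1) (hf i c1)
      have m2 := sub_mem (hf j b2) (hf j c2)
      have m3 := sub_mem (hf k b3) (hf k c3)
      have e1 := h.indep hij hik hjk m1 m2 m3 hsum
      have e2 := h.indep hij.symm hjk hik m2 m1 m3 (by rw [← hsum]; abel)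
      have e3 := h.indep hik.symm hjk.symm hij m3 m1 m2 (by rw [← hsum]; abel)
      rw [hfinj _ _ _ (sub_eq_zero.1 e1), hfinj _ _ _ (sub_eq_zero.1 e2),
        hfinj _ _ _ (sub_eq_zero.1 e3)]
    · have hsup : ∀ m, ∀ x ∈ A m, x ∈ A i ⊔ A j ⊔ A k := fun m x hx => by
        rcases hall m with rfl | rfl | rfl
        · exact AddSubgroup.mem_sup_left (AddSubgroup.mem_sup_left hx)
        · exact AddSubgroup.mem_sup_left (AddSubgroup.mem_sup_right hx)
        · exact AddSubgroup.mem_sup_right hx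
      have key : ∀ w, w ∉ S i → w ∈ A i ⊔ A j ⊔ A k := fun w hw => by
        obtain ⟨a, ha, m, -, d, hd, rfl⟩ := h.cover i w hw
        exact add_mem (hsup _ _ ha) (hsup _ _ hd)
      intro w
      have hw : w ∈ A i ⊔ A j ⊔ A k := by
        by_cases hw : w ∈ S i
        · have := key (w + t j) fun hwc =>
            ht0 j (h.disjoint hij (by simpa using sub_mem hwc hw) (ht j))
          simpa using sub_mem this (hsup _ _ (ht j))
        · exact key w hw
      obtain ⟨y, hy, z, hz, rfl⟩ := AddSubgroup.mem_sup.1 hw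
      obtain ⟨x, hx, y, hy', rfl⟩ := AddSubgroup.mem_sup.1 hy
      obtain ⟨b1, rfl⟩ := hmem hx
      obtain ⟨b2, rfl⟩ := hmem hy'
      obtain ⟨b3, rfl⟩ := hmem hz
      exact ⟨(b1, b2, b3), rfl⟩
  rw [← Nat.card_eq_of_bijective F hF]
  simp

end OrderTwo

/-- A nonzero endomorphism preserving the components kills no nonzero element of a component,
except if there are only three components and these have order two. -/
theorem exceptional_of_map_eq_zero {α : G →+ G} (hα : ∀ i, ∀ x ∈ A i, α x ∈ A i) (hα0 : α ≠ 0)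
    {i : ι} {a : G} (ha : a ∈ A i) (ha0 : a ≠ 0) (hαa : α a = 0) :
    (∀ m, ∀ x ∈ A m, ∀ y ∈ A m, x ≠ 0 → y ≠ 0 → x = y) ∧
      ∃ i j k : ι, i ≠ j ∧ i ≠ k ∧ j ≠ k ∧ ∀ m, m = i ∨ m = j ∨ m = k := by
  -- Otherwise killing one nonzero element of `A i` kills all other components, and any of these in
  -- turn kills `A i`, so α = 0.
  have hex : ∃ i j, i ≠ j ∧ ∃ a ∈ A i, a ≠ 0 ∧ α a = 0 ∧ ∃ c ∈ A j, α c ≠ 0 := by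
    by_contra hcon
    push Not at hcon
    have h1 : ∀ j, i ≠ j → ∀ c ∈ A j, α c = 0 := fun j hij => hcon i j hij a ha ha0 hαa
    refine hα0 (h.eq_zero_of_forall_mem fun m x hx => ?_)
    by_cases him : i = m
    · subst him
      obtain ⟨j, hji⟩ := h.exists_other i
      obtain ⟨b, hb, hb0⟩ := h.exists_ne_zero j
      exact hcon j i hji b hb hb0 (h1 j hji.symm b hb) x hx
    · exact h1 m him x hx
  obtain ⟨i, j, hij, a, ha, ha0, hαa, c, hc, hαc⟩ := hex
  have htwo : ∀ m, ∀ x ∈ A m, ∀ y ∈ A m, x ≠ 0 → y ≠ 0 → x = y := fun m x hx y hy hx0 hy0 =>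
    h.eq_of_ne_zero hα hij ha ha0 hαa hc hαc m hx hy hx0 hy0
  refine ⟨htwo, ?_⟩
  obtain ⟨k, hki, hkj⟩ := h.exists_third i j
  refine ⟨i, j, k, hij, hki.symm, hkj.symm, fun m => ?_⟩
  by_contra! hm
  choose t ht ht0 using h.exists_ne_zero
  have hi := htwo i a ha (t i) (ht i) ha0 (ht0 i)
  have hj := htwo j c hc (t j) (ht j) (fun hc0 => hαc (by rw [hc0, map_zero])) (ht0 j)
  exact h.false_of_four htwo ht ht0 hα hij hki.symm hkj.symm hm.1.symm hm.2.1.symm hm.2.2.symm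
    (hi ▸ hαa) (hj ▸ hαc)

section Injective

variable {α : G →+ G} (hα : ∀ i, ∀ x ∈ A i, α x ∈ A i) (hinj : ∀ i, ∀ x ∈ A i, α x = 0 → x = 0)
include hα hinj

theorem injective_of_forall_mem : Function.Injective α := by
  rw [injective_iff_map_eq_zero]
  intro w hw
  obtain ⟨i, -⟩ := h.exists_three
  obtain ⟨j, hji⟩ := h.exists_other i
  have key : ∀ v, v ∉ S i → α v = 0 → v = 0 := fun v hv hv0 => by
    obtain ⟨a, ha, m, hmi, d, hd, rfl⟩ := h.cover i v hv
    rw [map_add] at hv0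
    have h1 : α a = 0 := h.eq_zero_of_mem hmi.symm (hα _ _ ha)
      (by rw [eq_neg_of_add_eq_zero_left hv0]; exact neg_mem (hα _ _ hd))
    rw [h1, zero_add] at hv0
    rw [hinj _ _ ha h1, hinj _ _ hd hv0, add_zero]
  by_cases hwS : w ∈ S i
  swap
  · exact key w hwS hw
  obtain ⟨c, hc, hc0⟩ := h.exists_ne_zero j
  obtain ⟨a, ha, m, hmi, d, hd, hwc⟩ := h.cover i (w + c) fun hwc =>
    hc0 (h.disjoint hji.symm (by simpa using sub_mem hwc hwS) hc)
  have h1 : α c = α a + α d := by rw [← map_add, ← hwc, map_add, hw, zero_add]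
  by_cases hmj : m = j
  · subst hmj
    have h2 : α a = 0 := h.eq_zero_of_mem hmi.symm (hα _ _ ha)
      (by rw [eq_sub_of_add_eq h1.symm]; exact sub_mem (hα _ _ hc) (hα _ _ hd))
    have h3 : a = 0 := hinj _ _ ha h2
    rw [h3, zero_add] at hwc
    have h4 : w ∈ A m := by rw [eq_sub_of_add_eq hwc]; exact sub_mem hd hc
    exact hinj _ _ h4 hw
  · have h2 : α c = 0 := h.indep hji (Ne.symm hmj) hmi.symm (hα _ _ hc) (neg_mem (hα _ _ ha))
      (neg_mem (hα _ _ hd)) (by rw [h1]; abel)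
    exact (hc0 (hinj _ _ hc h2)).elim

/-- Only the subgroups `A i` are preserved by assumption. That `S i` is respected follows by
decomposing elements outside it with `cover` and comparing with the images; the induced map on
points needs this. -/
theorem map_mem_iff (i : ι) (w : G) : α w ∈ S i ↔ w ∈ S i := by
  constructor
  · intro hw
    by_contra hcon
    obtain ⟨a, ha, m, hmi, d, hd, rfl⟩ := h.cover i w hcon
    rw [map_add] at hw
    have h1 : α d ∈ S i := by
      have := sub_mem hw (h.le _ (hα _ _ ha))
      rwa [add_sub_cancel_left] at this
    have h2 := hinj _ _ hd (h.disjoint hmi.symm h1 (hα _ _ hd))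
    rw [h2, add_zero] at hcon
    exact hcon (h.le _ ha)
  · intro hw
    by_contra hcon
    obtain ⟨a, ha, j, hji, e, he, hαw⟩ := h.cover i _ hcon
    obtain ⟨c, hc, hc0⟩ := h.exists_ne_zero j
    obtain ⟨b, hb, m, hmi, d, hd, hwc⟩ := h.cover i (w + c) fun hwc =>
      hc0 (h.disjoint hji.symm (by simpa using sub_mem hwc hw) hc)
    have hsum : a + e + α c = α b + α d := by rw [← hαw, ← map_add, hwc, map_add]
    by_cases hmj : m = j
    · subst hmj
      have h1 : d - c = 0 := h.disjoint hmi.symm (by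
        rw [show d - c = w - b by rw [sub_eq_sub_iff_add_eq_add, hwc]; abel]
        exact sub_mem hw (h.le _ hb)) (sub_mem hd hc)
      have h2 : w = b := by rw [sub_eq_zero.1 h1] at hwc; exact add_right_cancel hwc
      exact hcon (h.le _ (hα _ _ (h2 ▸ hb)))
    · have h1 : α d = 0 := h.indep hmi hmj hji.symm (hα _ _ hd)
        (sub_mem (hα _ _ hb) ha) (neg_mem (add_mem he (hα _ _ hc)))
        (by rw [← sub_eq_zero] at hsum; rw [← neg_eq_zero, ← hsum]; abel)
      rw [hinj _ _ hd h1, add_zero] at hwc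
      refine hc0 (h.disjoint hji.symm ?_ hc)
      rw [eq_sub_of_add_eq' hwc]
      exact sub_mem (h.le _ hb) hw

/-- Reflection of the components puts the inverse of a bijective α into the kernel. -/
theorem map_mem_component_iff (i : ι) (w : G) : α w ∈ A i ↔ w ∈ A i := by
  refine ⟨fun hw => ?_, hα i w⟩
  have hwS : w ∈ S i := (h.map_mem_iff hα hinj i w).1 (h.le _ hw)
  obtain ⟨j, hji⟩ := h.exists_other i
  obtain ⟨c, hc, hc0⟩ := h.exists_ne_zero j
  obtain ⟨b, hb, m, hmi, d, hd, hwc⟩ := h.cover i (w + c) fun hwc =>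
    hc0 (h.disjoint hji.symm (by simpa using sub_mem hwc hwS) hc)
  have hsum : α w + α c = α b + α d := by rw [← map_add, hwc, map_add]
  by_cases hmj : m = j
  · subst hmj
    have h1 : d - c = 0 := h.disjoint hmi.symm (by
      rw [show d - c = w - b by rw [sub_eq_sub_iff_add_eq_add, hwc]; abel]
      exact sub_mem hwS (h.le _ hb)) (sub_mem hd hc)
    rw [sub_eq_zero.1 h1] at hwc
    exact add_right_cancel hwc ▸ hb
  · have h1 : α c = 0 := h.indep hji (Ne.symm hmj) hmi.symm (hα _ _ hc) (sub_mem hw (hα _ _ hb))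
      (neg_mem (hα _ _ hd)) (by rw [← sub_eq_zero] at hsum; rw [← hsum]; abel)
    exact (hc0 (hinj _ _ hc h1)).elim

end Injective

end IsTranslationFamily

/-! ### The classical axioms of generalized quadrangles. -/

namespace IncGeom.IsGeneralizedNGon

variable {Γ : IncGeom.{u}} (h : Γ.IsGeneralizedNGon 4)
include h

theorem eq_of_two_common {p q : Γ.Pt} {l m : Γ.Ln} (hpq : p ≠ q) (hpl : Γ.I p l) (hql : Γ.I q l)
    (hpm : Γ.I p m) (hqm : Γ.I q m) : l = m := by
  by_contra hlm
  refine (h.no_small_gon 2 le_rfl (by norm_num)).false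
    ⟨![p, q], ![l, m], fun i j hij => ?_, fun i j hij => ?_, fun i => ?_, fun i => ?_⟩
  · fin_cases i <;> fin_cases j <;> first | rfl | exact (hpq hij).elim | exact (hpq hij.symm).elim
  · fin_cases i <;> fin_cases j <;> first | rfl | exact (hlm hij).elim | exact (hlm hij.symm).elim
  · fin_cases i <;> assumption
  · fin_cases i <;> assumption

theorem eq_of_no_triangle {p q r : Γ.Pt} {l m k : Γ.Ln} (hp : ¬ Γ.I p l) (hq : Γ.I q l)
    (hr : Γ.I r l) (hpm : Γ.I p m) (hqm : Γ.I q m) (hpk : Γ.I p k) (hrk : Γ.I r k) : q = r := by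
  by_contra hqr
  have hpq : p ≠ q := fun e => hp (e ▸ hq)
  have hpr : p ≠ r := fun e => hp (e ▸ hr)
  have hlm : l ≠ m := fun e => hp (e ▸ hpm)
  have hlk : l ≠ k := fun e => hp (e ▸ hpk)
  have hmk : m ≠ k := fun e => hlm (h.eq_of_two_common hqr hq hr hqm (e ▸ hrk))
  refine (h.no_small_gon 3 (by norm_num) (by norm_num)).false
    ⟨![p, q, r], ![m, l, k], fun i j hij => ?_, fun i j hij => ?_, fun i => ?_, fun i => ?_⟩
  · fin_cases i <;> fin_cases j <;> first
      | rfl | exact (hpq hij).elim | exact (hpq hij.symm).elim | exact (hpr hij).elim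
      | exact (hpr hij.symm).elim | exact (hqr hij).elim | exact (hqr hij.symm).elim
  · fin_cases i <;> fin_cases j <;> first
      | rfl | exact (hlm hij).elim | exact (hlm hij.symm).elim | exact (hlk hij).elim
      | exact (hlk hij.symm).elim | exact (hmk hij).elim | exact (hmk hij.symm).elim
  · fin_cases i <;> assumption
  · fin_cases i <;> assumption

theorem exists_projection {p : Γ.Pt} {l : Γ.Ln} (hp : ¬ Γ.I p l) :
    ∃ q m, Γ.I q l ∧ Γ.I p m ∧ Γ.I q m := by
  obtain ⟨A, ⟨i, rfl⟩, ⟨j, rfl⟩⟩ := h.exists_gon (.inl p) (.inr l)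
  obtain ⟨d, rfl⟩ : ∃ d, j = i + d := ⟨j - i, by abel⟩
  have h3 : ∀ d : ZMod 4, d = 0 ∨ d = 1 ∨ d = 2 ∨ d = 3 := by decide
  have h4 : i + 3 + 1 = i := by
    rw [add_assoc, show (3 : ZMod 4) + 1 = 0 from rfl, add_zero]
  rcases h3 d with rfl | rfl | rfl | rfl
  · exact (hp (by simpa using A.inc_left i)).elim
  · exact ⟨A.p (i + 1), A.l i, A.inc_left _, A.inc_left _, A.inc_right _⟩
  · refine ⟨A.p (i + 3), A.l (i + 3), ?_, ?_, A.inc_left _⟩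
    · have := A.inc_right (i + 2)
      rwa [add_assoc, show (2 : ZMod 4) + 1 = 3 from rfl] at this
    · have := A.inc_right (i + 3)
      rwa [h4] at this
  · refine (hp ?_).elim
    have := A.inc_right (i + 3)
    rwa [h4] at this

end IncGeom.IsGeneralizedNGon

/-! ### Equivariant extension, and the geometry of translation quadrangles. -/

/-- A map on orbit representatives with the right stabilizers extends equivariantly. -/
theorem exists_injective_equivariant {T X : Type*} [Group T] (ρ : T →* Equiv.Perm X) (φ : T →* T)
    (R : X → Prop) (hrep : ∀ y, ∃ t r, R r ∧ ρ t r = y)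
    (huniq : ∀ t r r', R r → R r' → ρ t r = r' → r = r')
    (hstab : ∀ t r, R r → (ρ (φ t) r = r ↔ ρ t r = r)) :
    ∃ f : X → X, (∀ t r, R r → f (ρ t r) = ρ (φ t) r) ∧ Function.Injective f := by
  choose τ π hR hτ using hrep
  have hinv : ∀ s t r r', ρ s r = ρ t r' → ρ (t⁻¹ * s) r = r' := fun s t r r' e => by
    rw [map_mul, Equiv.Perm.mul_apply, e, ← Equiv.Perm.mul_apply, ← map_mul, inv_mul_cancel,
      map_one, Equiv.Perm.one_apply]
  have hinv' : ∀ s t r r', ρ (t⁻¹ * s) r = r' → ρ s r = ρ t r' := fun s t r r' e => by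
    rw [← e, ← Equiv.Perm.mul_apply, ← map_mul, mul_inv_cancel_left]
  have key : ∀ t r, R r → ρ (φ (τ (ρ t r))) (π (ρ t r)) = ρ (φ t) r := by
    intro t r hr
    have h1 := hinv _ _ _ _ (hτ (ρ t r))
    have h2 := huniq _ _ _ (hR _) hr h1
    rw [h2] at h1 ⊢
    refine hinv' _ _ _ _ ?_
    rw [← map_inv, ← map_mul]
    exact (hstab _ r hr).2 h1
  -- One direction of `hstab` makes the value independent of the chosen τ y, the other makes the map
  -- injective.
  refine ⟨fun y => ρ (φ (τ y)) (π y), key, fun y y' hy => ?_⟩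
  have h1 := hinv _ _ _ _ hy
  have h2 := huniq _ _ _ (hR _) (hR _) h1
  rw [← hτ y, ← hτ y']
  refine hinv' _ _ _ _ ?_
  rw [← h2] at h1 ⊢
  rw [← map_inv, ← map_mul] at h1
  exact (hstab _ _ (hR y)).1 h1

namespace TGQ

open IncGeom

variable (Q : TGQ.{u})

/-- The action of the translation group on the points. -/
def onPt : Q.T →* Equiv.Perm Q.Γ.Pt := (MonoidHom.fst _ _).comp Q.T.subtype

/-- The action of the translation group on the lines. -/
def onLn : Q.T →* Equiv.Perm Q.Γ.Ln := (MonoidHom.snd _ _).comp Q.T.subtype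

variable {Q}

theorem inc_iff (t : Q.T) {p : Q.Γ.Pt} {l : Q.Γ.Ln} :
    Q.Γ.I (Q.onPt t p) (Q.onLn t l) ↔ Q.Γ.I p l :=
  Q.isTranslationGroup.le_aut t.2 p l

theorem onLn_eq (t : Q.T) {l : Q.Γ.Ln} (hl : Q.Γ.I Q.x l) : Q.onLn t l = l :=
  Q.isTranslationGroup.fix t t.2 l hl

theorem inc_onPt_iff (t : Q.T) {p : Q.Γ.Pt} {l : Q.Γ.Ln} (hl : Q.Γ.I Q.x l) :
    Q.Γ.I (Q.onPt t p) l ↔ Q.Γ.I p l := by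
  rw [← inc_iff t (p := p), onLn_eq t hl]

theorem onPt_x (t : Q.T) : Q.onPt t Q.x = Q.x := by
  obtain ⟨a, b, c, ha, hb, -, hab, -⟩ := Q.isQuadrangle.exists_three_lines Q.x
  by_contra hne
  exact hab (Q.isQuadrangle.eq_of_two_common hne ((inc_onPt_iff t ha).2 ha) ha
    ((inc_onPt_iff t hb).2 hb) hb)

theorem onPt_inv_apply (t : Q.T) (p : Q.Γ.Pt) : Q.onPt t (Q.onPt t⁻¹ p) = p := by
  rw [← Equiv.Perm.mul_apply, ← map_mul, mul_inv_cancel, map_one, Equiv.Perm.one_apply]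

theorem onPt_inv_apply' (t : Q.T) (p : Q.Γ.Pt) : Q.onPt t⁻¹ (Q.onPt t p) = p := by
  rw [← Equiv.Perm.mul_apply, ← map_mul, inv_mul_cancel, map_one, Equiv.Perm.one_apply]

theorem onLn_inv_apply (t : Q.T) (p : Q.Γ.Ln) : Q.onLn t (Q.onLn t⁻¹ p) = p := by
  rw [← Equiv.Perm.mul_apply, ← map_mul, mul_inv_cancel, map_one, Equiv.Perm.one_apply]

theorem inc_inv_iff (t : Q.T) {p : Q.Γ.Pt} {l : Q.Γ.Ln} :
    Q.Γ.I p (Q.onLn t⁻¹ l) ↔ Q.Γ.I (Q.onPt t p) l := by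
  rw [← inc_iff t, onLn_inv_apply]

theorem isAffine_onPt_iff (t : Q.T) {p : Q.Γ.Pt} :
    Q.Γ.IsAffine Q.x (Q.onPt t p) ↔ Q.Γ.IsAffine Q.x p :=
  not_congr (exists_congr fun _ => and_congr_right fun hl => inc_onPt_iff t hl)

theorem exists_onPt_eq {y z : Q.Γ.Pt} (hy : Q.Γ.IsAffine Q.x y) (hz : Q.Γ.IsAffine Q.x z) :
    ∃ t : Q.T, Q.onPt t y = z := by
  obtain ⟨g, ⟨hg, he⟩, -⟩ := Q.isTranslationGroup.sharply_transitive y z hy hz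
  exact ⟨⟨g, hg⟩, he⟩

theorem eq_of_onPt_eq {y : Q.Γ.Pt} (hy : Q.Γ.IsAffine Q.x y) {s t : Q.T}
    (hst : Q.onPt s y = Q.onPt t y) : s = t :=
  Subtype.ext ((Q.isTranslationGroup.sharply_transitive y _ hy
    ((isAffine_onPt_iff t).2 hy)).unique ⟨s.2, hst⟩ ⟨t.2, rfl⟩)

theorem not_inc_x {z : Q.Γ.Pt} (hz : Q.Γ.IsAffine Q.x z) {V : Q.Γ.Ln} (hV : Q.Γ.I z V) :
    ¬ Q.Γ.I Q.x V := fun hx => hz ⟨V, hx, hV⟩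

theorem not_inc_of_isAffine {z : Q.Γ.Pt} (hz : Q.Γ.IsAffine Q.x z) {L : Q.Γ.Ln}
    (hL : Q.Γ.I Q.x L) : ¬ Q.Γ.I z L := fun hz' => hz ⟨L, hL, hz'⟩

variable (Q) in
/-- The point `p` of the line `V` is collinear with the translation point. -/
def IsFoot (p : Q.Γ.Pt) (V : Q.Γ.Ln) : Prop := Q.Γ.I p V ∧ ∃ L, Q.Γ.I Q.x L ∧ Q.Γ.I p L

theorem IsFoot.not_isAffine {p : Q.Γ.Pt} {V : Q.Γ.Ln} (h : Q.IsFoot p V) :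
    ¬ Q.Γ.IsAffine Q.x p := fun hp => hp h.2

theorem IsFoot.onPt {p : Q.Γ.Pt} {V : Q.Γ.Ln} (h : Q.IsFoot p V) (t : Q.T) :
    Q.IsFoot (Q.onPt t p) (Q.onLn t V) := by
  obtain ⟨hp, L, hL, hpL⟩ := h
  exact ⟨(inc_iff t).2 hp, L, hL, (inc_onPt_iff t hL).2 hpL⟩

theorem exists_isFoot {V : Q.Γ.Ln} (hV : ¬ Q.Γ.I Q.x V) : ∃ p, Q.IsFoot p V := by
  obtain ⟨p, L, hp, hL, hpL⟩ := Q.isQuadrangle.exists_projection hV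
  exact ⟨p, hp, L, hL, hpL⟩

theorem IsFoot.eq {V : Q.Γ.Ln} (hV : ¬ Q.Γ.I Q.x V) {p q : Q.Γ.Pt} (hp : Q.IsFoot p V)
    (hq : Q.IsFoot q V) : p = q := by
  obtain ⟨hp, L, hL, hpL⟩ := hp
  obtain ⟨hq, M, hM, hqM⟩ := hq
  exact Q.isQuadrangle.eq_of_no_triangle hV hp hq hL hpL hM hqM

theorem exists_isAffine_ne {V : Q.Γ.Ln} (hV : ¬ Q.Γ.I Q.x V) (y : Q.Γ.Pt) :
    ∃ q, Q.Γ.I q V ∧ Q.Γ.IsAffine Q.x q ∧ q ≠ y := by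
  obtain ⟨a, b, c, ha, hb, hc, hab, hac, hbc⟩ := Q.isQuadrangle.exists_three_points V
  have key : ∀ p q, Q.Γ.I p V → Q.Γ.I q V → p ≠ q →
      Q.Γ.IsAffine Q.x p ∨ Q.Γ.IsAffine Q.x q := fun p q hp hq hpq => by
    by_contra! hcon
    exact hpq (IsFoot.eq hV ⟨hp, not_not.1 hcon.1⟩ ⟨hq, not_not.1 hcon.2⟩)
  have two : ∀ p q, Q.Γ.I p V → Q.Γ.I q V → p ≠ q → p ≠ y → q ≠ y →
      ∃ q, Q.Γ.I q V ∧ Q.Γ.IsAffine Q.x q ∧ q ≠ y := fun p q hp hq hpq hpy hqy =>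
    (key p q hp hq hpq).elim (fun h => ⟨p, hp, h, hpy⟩) fun h => ⟨q, hq, h, hqy⟩
  by_cases hay : a = y
  · exact two b c hb hc hbc (hay ▸ hab.symm) (hay ▸ hac.symm)
  · by_cases hby : b = y
    · exact two a c ha hc hac hay (hby ▸ hbc.symm)
    · exact two a b ha hb hab hay hby

/-- The foot p of V and its image lie on the line xp and are both collinear with the image of z, so
they coincide; V and its image then share two points. -/
theorem onLn_eq_of_inc {z : Q.Γ.Pt} (hz : Q.Γ.IsAffine Q.x z) {V : Q.Γ.Ln} (hV : Q.Γ.I z V)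
    {t : Q.T} (ht : Q.Γ.I (Q.onPt t z) V) : Q.onLn t V = V := by
  obtain ⟨p, hp, L, hL, hpL⟩ := exists_isFoot (not_inc_x hz hV)
  have htz := (isAffine_onPt_iff t).2 hz
  have heq : p = Q.onPt t p := Q.isQuadrangle.eq_of_no_triangle (not_inc_of_isAffine htz hL) hpL
    ((inc_onPt_iff t hL).2 hpL) ht hp ((inc_iff t).2 hV) ((inc_iff t).2 hp)
  have hne : p ≠ Q.onPt t z := fun e => htz ⟨L, hL, by rwa [← e]⟩
  exact Q.isQuadrangle.eq_of_two_common hne (heq ▸ (inc_iff t).2 hp) ((inc_iff t).2 hV) hp ht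

theorem IsFoot.onPt_eq {V : Q.Γ.Ln} (hV : ¬ Q.Γ.I Q.x V) {p : Q.Γ.Pt} (hp : Q.IsFoot p V)
    {t : Q.T} (ht : Q.onLn t V = V) : Q.onPt t p = p :=
  IsFoot.eq hV (ht ▸ hp.onPt t) hp

/-- Distinct lines on an affine point have distinct feet. -/
theorem IsFoot.line_eq {z : Q.Γ.Pt} (hz : Q.Γ.IsAffine Q.x z) {V W : Q.Γ.Ln} (hV : Q.Γ.I z V)
    (hW : Q.Γ.I z W) {p : Q.Γ.Pt} (hp : Q.IsFoot p V) (hpW : Q.Γ.I p W) : V = W :=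
  Q.isQuadrangle.eq_of_two_common (fun e => hp.not_isAffine (by rwa [e])) hp.1 hV hpW hW

theorem IsFoot.eq_one {z : Q.Γ.Pt} (hz : Q.Γ.IsAffine Q.x z) {V W : Q.Γ.Ln} (hV : Q.Γ.I z V)
    (hW : Q.Γ.I z W) (hVW : V ≠ W) {p : Q.Γ.Pt} (hp : Q.IsFoot p V) {t : Q.T}
    (ht : Q.onPt t p = p) (htW : Q.onLn t W = W) : t = 1 := by
  have hpW : ¬ Q.Γ.I p W := fun h => hVW (hp.line_eq hz hV hW h)
  have h1 : Q.onPt t z = z := Q.isQuadrangle.eq_of_no_triangle hpW (htW ▸ (inc_iff t).2 hW) hW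
    (ht ▸ (inc_iff t).2 hp.1) ((inc_iff t).2 hV) hp.1 hV
  exact eq_of_onPt_eq hz (h1.trans (by rw [map_one, Equiv.Perm.one_apply]))

/-- The stabilizer of a point in the translation group. -/
def ptStab (Q : TGQ.{u}) (p : Q.Γ.Pt) : Subgroup Q.T where
  carrier := {t | Q.onPt t p = p}
  one_mem' := rfl
  mul_mem' := fun {a b} ha hb => by
    change Q.onPt (a * b) p = p
    rw [map_mul, Equiv.Perm.mul_apply, show Q.onPt b p = p from hb, show Q.onPt a p = p from ha]
  inv_mem' := fun {a} ha => by
    change Q.onPt a⁻¹ p = p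
    rw [map_inv, Equiv.Perm.inv_eq_iff_eq]
    exact (show Q.onPt a p = p from ha).symm

/-- Project wz to V. If the projection is affine, it is az with a stabilizing V, and a⁻¹w moves z
along a line through z. If it is the foot p, then p, wp and wz would form a triangle. -/
theorem exists_mul_of_onPt_ne {z : Q.Γ.Pt} (hz : Q.Γ.IsAffine Q.x z) {V : Q.Γ.Ln}
    (hV : Q.Γ.I z V) {p : Q.Γ.Pt} (hp : Q.IsFoot p V) {w : Q.T} (hw : Q.onPt w p ≠ p) :
    ∃ a : Q.T, Q.onLn a V = V ∧ ∃ W, Q.Γ.I z W ∧ W ≠ V ∧ ∃ d : Q.T, Q.onLn d W = W ∧ w = a * d := by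
  have hwV : ¬ Q.Γ.I (Q.onPt w z) V := fun h =>
    hw (hp.onPt_eq (not_inc_x hz hV) (onLn_eq_of_inc hz hV h))
  obtain ⟨q, m, hqV, hwm, hqm⟩ := Q.isQuadrangle.exists_projection hwV
  by_cases hq : Q.Γ.IsAffine Q.x q
  · obtain ⟨a, rfl⟩ := exists_onPt_eq hz hq
    have haV := onLn_eq_of_inc hz hV hqV
    have hza : Q.Γ.I z (Q.onLn a⁻¹ m) := (inc_inv_iff a).2 hqm
    refine ⟨a, haV, Q.onLn a⁻¹ m, hza, fun e => hwV ?_, a⁻¹ * w, onLn_eq_of_inc hz hza ?_,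
      (mul_inv_cancel_left a w).symm⟩
    · rw [← haV, ← e, onLn_inv_apply]; exact hwm
    · rw [map_mul, Equiv.Perm.mul_apply]; exact (inc_iff _).2 hwm
  · have hqp : q = p := IsFoot.eq (not_inc_x hz hV) ⟨hqV, not_not.1 hq⟩ hp
    subst hqp
    obtain ⟨-, L, hL, hqL⟩ := id hp
    exact (hw (Q.isQuadrangle.eq_of_no_triangle
      (not_inc_of_isAffine ((isAffine_onPt_iff w).2 hz) hL) ((inc_onPt_iff w hL).2 hqL) hqL
      ((inc_iff w).2 hV) ((inc_iff w).2 hp.1) hwm hqm)).elim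

/-- The projection of wp to W is affine, say cz. Then cp and wp are points of the line xp collinear
with cz, hence equal. -/
theorem exists_onPt_foot_eq {z : Q.Γ.Pt} (hz : Q.Γ.IsAffine Q.x z) {V W : Q.Γ.Ln}
    (hV : Q.Γ.I z V) (hW : Q.Γ.I z W) (hVW : V ≠ W) {p : Q.Γ.Pt} (hp : Q.IsFoot p V) (w : Q.T) :
    ∃ c : Q.T, Q.onLn c W = W ∧ Q.onPt c p = Q.onPt w p := by
  obtain ⟨hpV, L, hL, hpL⟩ := id hp
  have hyL := (inc_onPt_iff w hL).2 hpL
  have hfoot : ∀ q, Q.IsFoot q W → ¬ Q.Γ.I q L := fun q hq hqL => by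
    have : q = p := Q.isQuadrangle.eq_of_no_triangle (not_inc_of_isAffine hz hL) hqL hpL hW hq.1
      hV hpV
    exact hVW (hp.line_eq hz hV hW (this ▸ hq.1))
  have hyW : ¬ Q.Γ.I (Q.onPt w p) W := fun h => hfoot _ ⟨h, L, hL, hyL⟩ hyL
  obtain ⟨q, m, hqW, hym, hqm⟩ := Q.isQuadrangle.exists_projection hyW
  have hq : Q.Γ.IsAffine Q.x q := by
    by_contra hq
    obtain ⟨M, hM, hqM⟩ := not_not.1 hq
    have h1 : Q.x = Q.onPt w p := Q.isQuadrangle.eq_of_no_triangle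
      (hfoot q ⟨hqW, M, hM, hqM⟩) hL hyL hqM hM hqm hym
    rw [← onPt_x w] at h1
    exact not_inc_x hz hV ((Q.onPt w).injective h1 ▸ hpV)
  obtain ⟨c, rfl⟩ := exists_onPt_eq hz hq
  exact ⟨c, onLn_eq_of_inc hz hW hqW, Q.isQuadrangle.eq_of_no_triangle
    (not_inc_of_isAffine hq hL) ((inc_onPt_iff c hL).2 hpL) hyL ((inc_iff c).2 hV)
    ((inc_iff c).2 hpV) hqm hym⟩

/-- The points z, az and abz = c⁻¹z would be the vertices of a triangle with sides U, aV and W. -/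
theorem eq_one_of_mul_eq_one {z : Q.Γ.Pt} (hz : Q.Γ.IsAffine Q.x z) {U V W : Q.Γ.Ln}
    (hU : Q.Γ.I z U) (hV : Q.Γ.I z V) (hW : Q.Γ.I z W) (hUV : U ≠ V) (hUW : U ≠ W)
    {a b c : Q.T} (ha : Q.onLn a U = U) (hb : Q.onLn b V = V) (hc : Q.onLn c W = W)
    (habc : a * b * c = 1) : a = 1 := by
  obtain ⟨p, hp⟩ := exists_isFoot (not_inc_x hz hU)
  have hap := hp.onPt_eq (not_inc_x hz hU) ha
  by_cases haW : Q.Γ.I (Q.onPt a z) W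
  · exact hp.eq_one hz hU hW hUW hap (onLn_eq_of_inc hz hW haW)
  · have hc' : c⁻¹ = a * b := (eq_inv_of_mul_eq_one_left habc).symm
    have hcW : Q.onLn c⁻¹ W = W := by rw [map_inv, Equiv.Perm.inv_eq_iff_eq, hc]
    have h1 : Q.onPt c⁻¹ z = z := Q.isQuadrangle.eq_of_no_triangle haW
      (hcW ▸ (inc_iff c⁻¹).2 hW) hW ((inc_iff a).2 hV)
      (by rw [hc', map_mul, Equiv.Perm.mul_apply]; exact (inc_iff a).2 (hb ▸ (inc_iff b).2 hV))
      (ha ▸ (inc_iff a).2 hU) hU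
    have h2 : c⁻¹ = 1 := eq_of_onPt_eq hz (h1.trans (by rw [map_one, Equiv.Perm.one_apply]))
    have h3 : a = b⁻¹ := eq_inv_of_mul_eq_one_left (hc'.symm.trans h2)
    refine hp.eq_one hz hU hV hUV hap ?_
    rw [h3, map_inv, Equiv.Perm.inv_eq_iff_eq, hb]

/-- The representatives of the point orbits of the translation group. -/
def IsBasePt (Q : TGQ.{u}) (z p : Q.Γ.Pt) : Prop :=
  p = Q.x ∨ p = z ∨ ∃ V, Q.Γ.I z V ∧ Q.IsFoot p V

/-- The representatives of the line orbits of the translation group. -/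
def IsBaseLn (Q : TGQ.{u}) (z : Q.Γ.Pt) (l : Q.Γ.Ln) : Prop := Q.Γ.I Q.x l ∨ Q.Γ.I z l

theorem not_isAffine_x : ¬ Q.Γ.IsAffine Q.x Q.x := by
  obtain ⟨a, b, c, ha, -⟩ := Q.isQuadrangle.exists_three_lines Q.x
  exact fun h => h ⟨a, ha, ha⟩

theorem exists_basePt {z : Q.Γ.Pt} (hz : Q.Γ.IsAffine Q.x z) (p : Q.Γ.Pt) :
    ∃ t r, Q.IsBasePt z r ∧ Q.onPt t r = p := by
  by_cases hp : Q.Γ.IsAffine Q.x p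
  · obtain ⟨t, ht⟩ := exists_onPt_eq hz hp
    exact ⟨t, z, Or.inr (Or.inl rfl), ht⟩
  by_cases hpx : p = Q.x
  · exact ⟨1, Q.x, Or.inl rfl, by rw [hpx, onPt_x]⟩
  obtain ⟨L, hL, hpL⟩ := not_not.1 hp
  obtain ⟨M, hM, hML⟩ : ∃ M, Q.Γ.I p M ∧ M ≠ L := by
    obtain ⟨a, b, c, ha, hb, -, hab, -⟩ := Q.isQuadrangle.exists_three_lines p
    by_cases haL : a = L
    · exact ⟨b, hb, fun e => hab (haL.trans e.symm)⟩
    · exact ⟨a, ha, haL⟩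
  have hxM : ¬ Q.Γ.I Q.x M := fun h =>
    hML (Q.isQuadrangle.eq_of_two_common hpx hM h hpL hL)
  obtain ⟨u, huM, hu, -⟩ := exists_isAffine_ne hxM p
  obtain ⟨t, rfl⟩ := exists_onPt_eq hz hu
  refine ⟨t, Q.onPt t⁻¹ p, Or.inr (Or.inr ⟨Q.onLn t⁻¹ M, (inc_inv_iff t).2 huM, ?_⟩),
    onPt_inv_apply t p⟩
  exact IsFoot.onPt ⟨hM, L, hL, hpL⟩ t⁻¹

theorem exists_baseLn {z : Q.Γ.Pt} (hz : Q.Γ.IsAffine Q.x z) (l : Q.Γ.Ln) :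
    ∃ t r, Q.IsBaseLn z r ∧ Q.onLn t r = l := by
  by_cases hl : Q.Γ.I Q.x l
  · exact ⟨1, l, Or.inl hl, by rw [onLn_eq _ hl]⟩
  · obtain ⟨u, hul, hu, -⟩ := exists_isAffine_ne hl Q.x
    obtain ⟨t, rfl⟩ := exists_onPt_eq hz hu
    exact ⟨t, Q.onLn t⁻¹ l, Or.inr ((inc_inv_iff t).2 hul), onLn_inv_apply t l⟩

theorem IsBasePt.eq {z : Q.Γ.Pt} (hz : Q.Γ.IsAffine Q.x z) (t : Q.T) (r r' : Q.Γ.Pt)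
    (hr : Q.IsBasePt z r) (hr' : Q.IsBasePt z r') (ht : Q.onPt t r = r') : r = r' := by
  rcases hr with rfl | rfl | ⟨V, hV, hr⟩
  · rw [← ht, onPt_x]
  · have := (isAffine_onPt_iff t).2 hz
    rw [ht] at this
    rcases hr' with rfl | rfl | ⟨V, hV, hr'⟩
    · exact (not_isAffine_x this).elim
    · rfl
    · exact (hr'.not_isAffine this).elim
  · have hna := hr.not_isAffine
    rw [← isAffine_onPt_iff t, ht] at hna
    rcases hr' with rfl | rfl | ⟨W, hW, hr'⟩
    · exact (Q.onPt t).injective (ht.trans (onPt_x t).symm)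
    · exact (hna hz).elim
    · obtain ⟨hrV, L, hL, hrL⟩ := hr
      exact Q.isQuadrangle.eq_of_no_triangle (not_inc_of_isAffine hz hL) hrL
        (ht ▸ (inc_onPt_iff t hL).2 hrL) hV hrV hW hr'.1

theorem IsBaseLn.eq {z : Q.Γ.Pt} (hz : Q.Γ.IsAffine Q.x z) (t : Q.T) (l l' : Q.Γ.Ln)
    (hl : Q.IsBaseLn z l) (hl' : Q.IsBaseLn z l') (ht : Q.onLn t l = l') : l = l' := by
  rcases hl with hl | hl
  · rw [← ht, onLn_eq t hl]
  rcases hl' with hl' | hl'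
  · rw [← ht, ← onPt_x t] at hl'
    exact (not_inc_x hz hl ((inc_iff t).1 hl')).elim
  obtain ⟨p, hp, L, hL, hpL⟩ := exists_isFoot (not_inc_x hz hl)
  have heq : p = Q.onPt t p := Q.isQuadrangle.eq_of_no_triangle (not_inc_of_isAffine hz hL) hpL
    ((inc_onPt_iff t hL).2 hpL) hl hp hl' (ht ▸ (inc_iff t).2 hp)
  exact IsFoot.line_eq hz hl hl' ⟨hp, L, hL, hpL⟩ (by rw [heq, ← ht]; exact (inc_iff t).2 hp)

/-- A single translation carries a base flag to the given one, so the equivariant maps on points and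
lines move both elements by the same group element and preserve incidence. -/
theorem exists_base_flag {z : Q.Γ.Pt} (hz : Q.Γ.IsAffine Q.x z) {p : Q.Γ.Pt} {l : Q.Γ.Ln}
    (hpl : Q.Γ.I p l) : ∃ t r m, Q.IsBasePt z r ∧ Q.IsBaseLn z m ∧ Q.onPt t r = p ∧
      Q.onLn t m = l ∧ Q.Γ.I r m := by
  by_cases hl : Q.Γ.I Q.x l
  · obtain ⟨t, r, hr, rfl⟩ := exists_basePt hz p
    exact ⟨t, r, l, hr, Or.inl hl, rfl, onLn_eq t hl, (inc_onPt_iff t hl).1 hpl⟩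
  · obtain ⟨t, m, hm, rfl⟩ := exists_baseLn hz l
    have hm' : Q.Γ.I z m := hm.resolve_left fun h => hl (by rwa [onLn_eq t h])
    have hpm : Q.Γ.I (Q.onPt t⁻¹ p) m := by rwa [← inc_iff t, onPt_inv_apply]
    by_cases hp : Q.Γ.IsAffine Q.x (Q.onPt t⁻¹ p)
    · obtain ⟨v, hv⟩ := exists_onPt_eq hz hp
      have hvm := onLn_eq_of_inc hz hm' (hv ▸ hpm)
      refine ⟨t * v, z, m, Or.inr (Or.inl rfl), hm, ?_, ?_, hm'⟩
      · rw [map_mul, Equiv.Perm.mul_apply, hv, onPt_inv_apply]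
      · rw [map_mul, Equiv.Perm.mul_apply, hvm]
    · exact ⟨t, Q.onPt t⁻¹ p, m, Or.inr (Or.inr ⟨m, hm', hpm, not_not.1 hp⟩), hm,
        onPt_inv_apply t p, rfl, hpm⟩

/-- An injective endomorphism of the translation group that respects the stabilizers of the lines on
an affine point and of their feet, but is not surjective, yields an object of the category. -/
theorem exists_catE {z : Q.Γ.Pt} (hz : Q.Γ.IsAffine Q.x z) (φ : Q.T →* Q.T)
    (hinj : Function.Injective φ) (hsurj : ¬ Function.Surjective φ)
    (hln : ∀ V, Q.Γ.I z V → ∀ t, Q.onLn (φ t) V = V ↔ Q.onLn t V = V)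
    (hpt : ∀ V, Q.Γ.I z V → ∀ p, Q.IsFoot p V → ∀ t, Q.onPt (φ t) p = p ↔ Q.onPt t p = p) :
    ∃ B : CatE.{u}, B.IsTGQ := by
  have hz1 : ∀ t : Q.T, Q.onPt t z = z ↔ t = 1 := fun t =>
    ⟨fun ht => eq_of_onPt_eq hz (ht.trans (by rw [map_one, Equiv.Perm.one_apply])), fun ht => by
      rw [ht, map_one, Equiv.Perm.one_apply]⟩
  obtain ⟨f, hf, hfinj⟩ := exists_injective_equivariant Q.onPt φ (Q.IsBasePt z) (exists_basePt hz)
    (IsBasePt.eq hz) (by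
      rintro t r (rfl | rfl | ⟨V, hV, hr⟩)
      · simp only [onPt_x]
      · rw [hz1, hz1, map_eq_one_iff φ hinj]
      · exact hpt V hV r hr t)
  obtain ⟨g, hg, hginj⟩ := exists_injective_equivariant Q.onLn φ (Q.IsBaseLn z) (exists_baseLn hz)
    (IsBaseLn.eq hz) (by
      rintro t r (hr | hr)
      · simp only [onLn_eq _ hr]
      · exact hln r hr t)
  refine ⟨⟨⟨Q.Γ, ⟨4, Q.isQuadrangle⟩, .inl Q.x⟩, ⟨f, g, fun p l hpl => ?_⟩, ⟨?_, fun l hl => ?_⟩,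
    Sum.map_injective.2 ⟨hfinj, hginj⟩, fun hb => hsurj fun w => ?_⟩,
    Q.x, rfl, Q.isQuadrangle, Q.T, Q.isTranslationGroup⟩
  · obtain ⟨t, r, m, hr, hm, rfl, rfl, hrm⟩ := exists_base_flag hz hpl
    rw [hf t r hr, hg t m hm]
    exact (inc_iff _).2 hrm
  · have := hf 1 Q.x (Or.inl rfl)
    rwa [onPt_x, onPt_x] at this
  · have := hg 1 l (Or.inl hl)
    rwa [onLn_eq _ hl, onLn_eq _ hl] at this
  -- A preimage of wz lies in the orbit of z, say tz, and sharp transitivity gives φ t = w.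
  · obtain ⟨p, hp⟩ := (Sum.map_surjective.1 hb.2).1 (Q.onPt w z)
    obtain ⟨t, r, hr, rfl⟩ := exists_basePt hz p
    have hp' : f (Q.onPt t r) = Q.onPt w z := hp
    rw [hf t r hr] at hp'
    have hrz : r = z := by
      refine IsBasePt.eq hz (w⁻¹ * φ t) r z hr (Or.inr (Or.inl rfl)) ?_
      rw [map_mul, Equiv.Perm.mul_apply, hp', ← Equiv.Perm.mul_apply, ← map_mul, inv_mul_cancel,
        map_one, Equiv.Perm.one_apply]
    exact ⟨t, eq_of_onPt_eq hz (hrz ▸ hp')⟩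

section Family

variable {z : Q.Γ.Pt} (hz : Q.Γ.IsAffine Q.x z)

/-- The foot of a line on an affine point. -/
noncomputable def foot (V : {V // Q.Γ.I z V}) : Q.Γ.Pt := (exists_isFoot (not_inc_x hz V.2)).choose

theorem isFoot_foot (V : {V // Q.Γ.I z V}) : Q.IsFoot (foot hz V) V :=
  (exists_isFoot (not_inc_x hz V.2)).choose_spec

/-- The stabilizers of the lines on an affine point. -/
def lineFamily (Q : TGQ.{u}) (z : Q.Γ.Pt) (V : {V // Q.Γ.I z V}) : AddSubgroup (Additive Q.T) :=
  (Q.lineStab V).toAddSubgroup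

/-- The stabilizers of the feet of the lines on an affine point. -/
noncomputable def footFamily (V : {V // Q.Γ.I z V}) : AddSubgroup (Additive Q.T) :=
  (Q.ptStab (foot hz V)).toAddSubgroup

theorem mem_footFamily {V : {V // Q.Γ.I z V}} {t : Additive Q.T} :
    t ∈ footFamily hz V ↔ Q.onPt t.toMul (foot hz V) = foot hz V := Iff.rfl

theorem isTranslationFamily : IsTranslationFamily (lineFamily Q z) (footFamily hz) where
  le V _ ht := (isFoot_foot hz V).onPt_eq (not_inc_x hz V.2) ht
  disjoint {V W} hVW t ht ht' :=
    (isFoot_foot hz V).eq_one hz V.2 W.2 (fun e => hVW (Subtype.ext e)) ht ht'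
  cover V w hw := by
    obtain ⟨a, ha, W, hW, hWV, d, hd, he⟩ :=
      exists_mul_of_onPt_ne hz V.2 (isFoot_foot hz V) (w := w.toMul) hw
    exact ⟨.ofMul a, ha, ⟨W, hW⟩, fun e => hWV (congrArg Subtype.val e), .ofMul d, hd, he⟩
  indep {U V W} hUV hUW _ a b c ha hb hc habc :=
    eq_one_of_mul_eq_one hz U.2 V.2 W.2 (fun e => hUV (Subtype.ext e))
      (fun e => hUW (Subtype.ext e)) ha hb hc habc
  exists_ne_zero V := by
    obtain ⟨q, hqV, hq, hqz⟩ := exists_isAffine_ne (not_inc_x hz V.2) z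
    obtain ⟨t, rfl⟩ := exists_onPt_eq hz hq
    exact ⟨.ofMul t, onLn_eq_of_inc hz V.2 hqV, fun h0 => hqz (by
      rw [show t = 1 from h0, map_one, Equiv.Perm.one_apply])⟩
  exists_three := by
    obtain ⟨a, b, c, ha, hb, hc, hab, hac, hbc⟩ := Q.isQuadrangle.exists_three_lines z
    exact ⟨⟨a, ha⟩, ⟨b, hb⟩, ⟨c, hc⟩, by simpa using hab, by simpa using hac, by simpa using hbc⟩
  compl {V W} hVW w := by
    obtain ⟨c, hc, he⟩ := exists_onPt_foot_eq hz V.2 W.2 (fun e => hVW (Subtype.ext e))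
      (isFoot_foot hz V) w.toMul
    refine ⟨.ofMul c, hc, ?_⟩
    rw [mem_footFamily, sub_eq_neg_add]
    change Q.onPt (c⁻¹ * w.toMul) _ = _
    rw [map_mul, Equiv.Perm.mul_apply, ← he, onPt_inv_apply']

-- The count is 15 = 1 + 8 + 3 · 2: the point x, the affine points, and two translates of each of
-- the three feet.
include hz in
theorem card_pt_eq_fifteen
    (htwo : ∀ V, ∀ x ∈ lineFamily Q z V, ∀ y ∈ lineFamily Q z V, x ≠ 0 → y ≠ 0 → x = y)
    {U V W : {V // Q.Γ.I z V}} (hUV : U ≠ V) (hUW : U ≠ W) (hVW : V ≠ W)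
    (hall : ∀ m, m = U ∨ m = V ∨ m = W) : Nat.card Q.Γ.Pt = 15 := by
  have hfam := isTranslationFamily hz
  choose t ht ht0 using hfam.exists_ne_zero
  choose σ hσ using hfam.exists_other
  have hT : Nat.card Q.T = 8 := hfam.card_eq_eight htwo ht ht0 hUV hUW hVW hall
  have hι : Nat.card {V // Q.Γ.I z V} = 3 := by
    rw [← Nat.card_eq_of_bijective ![U, V, W], Nat.card_fin]
    constructor
    · intro i j hij
      fin_cases i <;> fin_cases j <;> first
        | rfl | exact (hUV hij).elim | exact (hUV hij.symm).elim | exact (hUW hij).elim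
        | exact (hUW hij.symm).elim | exact (hVW hij).elim | exact (hVW hij.symm).elim
    · intro m
      rcases hall m with rfl | rfl | rfl
      exacts [⟨0, rfl⟩, ⟨1, rfl⟩, ⟨2, rfl⟩]
  -- The stabilizer of another line `σ i`, of order two, is already transitive on the orbit of the
  -- foot of line i.
  let c : {V // Q.Γ.I z V} → Bool → Q.T := fun i b => if b then (t (σ i)).toMul else 1
  let F : (Unit ⊕ Q.T) ⊕ ({V // Q.Γ.I z V} × Bool) → Q.Γ.Pt :=
    Sum.elim (Sum.elim (fun _ => Q.x) fun s => Q.onPt s z) fun i => Q.onPt (c i.1 i.2) (foot hz i.1)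
  have hF : Function.Bijective F := by
    have hnz : ∀ s, Q.Γ.IsAffine Q.x (Q.onPt s z) := fun s => (isAffine_onPt_iff s).2 hz
    have hnf : ∀ s i, ¬ Q.Γ.IsAffine Q.x (Q.onPt s (foot hz i)) := fun s i => by
      rw [isAffine_onPt_iff]; exact (isFoot_foot hz i).not_isAffine
    have hxf : ∀ s i, Q.onPt s (foot hz i) ≠ Q.x := fun s i e => by
      have := (Q.onPt s).injective (e.trans (onPt_x s).symm)
      exact not_inc_x hz i.2 (this ▸ (isFoot_foot hz i).1)
    have hts : ∀ i, Q.onPt (t (σ i)).toMul (foot hz i) ≠ foot hz i := fun i e =>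
      ht0 (σ i) (hfam.disjoint (hσ i).symm e (ht (σ i)))
    constructor
    · rintro ((⟨⟩ | s) | ⟨i, b⟩) ((⟨⟩ | s') | ⟨j, b'⟩) he <;> simp only [F, Sum.elim_inl, Sum.elim_inr] at he
      · rfl
      · exact (not_isAffine_x (Q := Q) (by have := hnz s'; rwa [← he] at this)).elim
      · exact (hxf _ _ he.symm).elim
      · exact (not_isAffine_x (Q := Q) (by have := hnz s; rwa [he] at this)).elim
      · rw [eq_of_onPt_eq hz he]
      · exact (hnf _ _ (he ▸ hnz s)).elim
      · exact (hxf _ _ he).elim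
      · exact (hnf _ _ (he ▸ hnz s')).elim
      · have hij : i = j := by
          have hb : ∀ i, Q.IsBasePt z (foot hz i) := fun i => Or.inr (Or.inr ⟨i, i.2, isFoot_foot hz i⟩)
          have : foot hz i = foot hz j := by
            refine IsBasePt.eq hz ((c j b')⁻¹ * c i b) _ _ (hb i) (hb j) ?_
            rw [map_mul, Equiv.Perm.mul_apply, he, onPt_inv_apply']
          exact Subtype.ext ((isFoot_foot hz i).line_eq hz i.2 j.2 (this ▸ (isFoot_foot hz j).1))
        subst hij
        cases b <;> cases b'
        · rfl
        · exact (hts i he.symm).elim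
        · exact (hts i he).elim
        · rfl
    · intro p
      obtain ⟨s, r, rfl | rfl | ⟨i, hi, hr⟩, rfl⟩ := exists_basePt hz p
      · exact ⟨.inl (.inl ()), (onPt_x s).symm⟩
      · exact ⟨.inl (.inr s), rfl⟩
      · have hri : r = foot hz ⟨i, hi⟩ := hr.eq (not_inc_x hz hi) (isFoot_foot hz ⟨i, hi⟩)
        subst hri
        obtain ⟨d, hd, hde⟩ := exists_onPt_foot_eq hz hi (σ ⟨i, hi⟩).2
          (fun e => hσ ⟨i, hi⟩ (Subtype.ext e.symm)) hr s
        rcases IsTranslationFamily.eq_zero_or_eq htwo ht ht0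
          (x := Additive.ofMul d) (i := σ ⟨i, hi⟩) hd with h0 | h1
        · exact ⟨.inr (⟨i, hi⟩, false), by rw [← hde, show d = 1 from h0]; rfl⟩
        · exact ⟨.inr (⟨i, hi⟩, true), by rw [← hde, show d = (t (σ ⟨i, hi⟩)).toMul from h1]; rfl⟩
  have : Finite Q.T := Nat.finite_of_card_ne_zero (by rw [hT]; norm_num)
  have : Finite {V // Q.Γ.I z V} := Nat.finite_of_card_ne_zero (by rw [hι]; norm_num)
  rw [← Nat.card_eq_of_bijective F hF, Nat.card_sum, Nat.card_sum, Nat.card_prod, hT, hι]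
  simp

end Family

/-- A translation quadrangle that is not linear and does not have 15 points yields an object of the
category. -/
theorem exists_catE_of_not_isLinear (h15 : Nat.card Q.Γ.Pt ≠ 15) (hQ : ¬ Q.IsLinear) :
    ∃ B : CatE.{u}, B.IsTGQ := by
  by_contra hcon
  refine hQ fun z hz => ⟨⟨0, 1, fun h01 => ?_⟩, fun a ha => ?_⟩
  · obtain ⟨V, -⟩ := (isTranslationFamily hz).exists_three
    obtain ⟨t, -, ht0⟩ := (isTranslationFamily hz).exists_ne_zero V
    exact ht0 (DFunLike.congr_fun (congrArg Subtype.val h01) t).symm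
  have hfam := isTranslationFamily hz
  obtain ⟨α, hαk⟩ := a
  have hα : ∀ V, ∀ x ∈ lineFamily Q z V, α x ∈ lineFamily Q z V := fun V x hx =>
    hαk V.1 V.2 x.toMul hx
  have hinj : ∀ V, ∀ x ∈ lineFamily Q z V, α x = 0 → x = 0 := by
    intro V x hx hαx
    by_contra hx0
    obtain ⟨htwo, U, V, W, hUV, hUW, hVW, hall⟩ :=
      hfam.exceptional_of_map_eq_zero hα (fun h0 => ha (Subtype.ext h0)) hx hx0 hαx
    exact h15 (card_pt_eq_fifteen hz htwo hUV hUW hVW hall)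
  have hαinj := hfam.injective_of_forall_mem hα hinj
  -- This is the only use of the assumption that the category has no translation quadrangle.
  have hαsurj : Function.Surjective α := by
    by_contra hs
    refine hcon (exists_catE hz (AddMonoidHom.toMultiplicative α) hαinj hs
      (fun V hV t => hfam.map_mem_component_iff hα hinj ⟨V, hV⟩ (.ofMul t)) fun V hV p hp t => ?_)
    have : p = foot hz ⟨V, hV⟩ := hp.eq (not_inc_x hz hV) (isFoot_foot hz ⟨V, hV⟩)
    subst this
    exact hfam.map_mem_iff hα hinj ⟨V, hV⟩ (.ofMul t)
  let e := AddEquiv.ofBijective α ⟨hαinj, hαsurj⟩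
  have heα : ∀ x, α (e.symm x) = x := e.apply_symm_apply
  refine isUnit_iff_exists.2 ⟨⟨e.symm.toAddMonoidHom, fun V hV t ht => ?_⟩, ?_, ?_⟩
  · refine (hfam.map_mem_component_iff hα hinj ⟨V, hV⟩ (e.symm (.ofMul t))).1 ?_
    exact (heα (.ofMul t)).symm ▸ ht
  · exact Subtype.ext (AddMonoidHom.ext heα)
  · exact Subtype.ext (AddMonoidHom.ext e.symm_apply_apply)

end TGQ

theorem theorem3p1 :
    -- the main implication
    (IsEmpty CatE.{u} →
      (¬ ∃ Γ : IncGeom.{u}, Γ.IsGeneralizedPolygon ∧ Γ.IsLocallyFinite) ∧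
        ∀ Q : TGQ.{u}, Nat.card Q.Γ.Pt ≠ 15 → Q.IsLinear) ∧
    -- the locally finite part of the category decides the first claim
    ((∀ A : CatE.{u}, ¬ A.X.Γ.IsLocallyFinite) →
      ¬ ∃ Γ : IncGeom.{u}, Γ.IsGeneralizedPolygon ∧ Γ.IsLocallyFinite) ∧
    -- the translation quadrangles in the category decide the second claim
    ((∀ A : CatE.{u}, ¬ A.IsTGQ) →
      ∀ Q : TGQ.{u}, Nat.card Q.Γ.Pt ≠ 15 → Q.IsLinear) := by
  have ha : (∀ A : CatE.{u}, ¬ A.X.Γ.IsLocallyFinite) →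
      ¬ ∃ Γ : IncGeom.{u}, Γ.IsGeneralizedPolygon ∧ Γ.IsLocallyFinite := by
    rintro h ⟨Γ, hΓ, hf⟩
    obtain ⟨A, hA⟩ := IncGeom.exists_catE_of_isLocallyFinite hΓ hf
    exact h A hA
  have hb : (∀ A : CatE.{u}, ¬ A.IsTGQ) →
      ∀ Q : TGQ.{u}, Nat.card Q.Γ.Pt ≠ 15 → Q.IsLinear := by
    intro h Q h15
    by_contra hQ
    obtain ⟨A, hA⟩ := TGQ.exists_catE_of_not_isLinear h15 hQ
    exact h A hA
  exact ⟨fun h => ⟨ha fun A => h.elim A, hb fun A => h.elim A⟩, ha, hb⟩
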